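/- **Conventions.** Fix a countable alphabet and let $\mathcal{U}$ be the set of finite presentations whose generators are in that alphabet. A class of groups is an isomorphism-closed subset of $\mathcal{U}$; for a group $G$, $\{G\}$ denotes the set of finite presentations of groups isomorphic to $G$. The word problem is uniformly solvable in $\mathcal{D}\subseteq\mathcal{U}$ if there is one algorithm which, given any $P\in\mathcal{D}$ and any word in the generators of $P$, decides whether the word is trivial in the group presented by $P$ (with no requirement on its behaviour on $P\notin\mathcal{D}$). A subset $\mathcal{C}\subseteq\mathcal{D}$ is recursive in $\mathcal{D}$ if there are recursively enumerable sets $\mathcal{X},\mathcal{Y}\subseteq\mathcal{U}$ with $\mathcal{C}\subseteq\mathcal{X}$, $(\mathcal{D}\smallsetminus\mathcal{C})\cap\mathcal{X}=\varnothing$, $\mathcal{D}\smallsetminus\mathcal{C}\subseteq\mathcal{Y}$ and $\mathcal{C}\cap\mathcal{Y}=\varnothing$. A class of groups $\mathcal{C}$ is recursive modulo the word problem if $\mathcal{C}\cap\mathcal{D}$ is recursive in $\mathcal{D}$ for every $\mathcal{D}\subseteq\mathcal{U}$ in which the word problem is uniformly solvable. For a class of groups $\mathcal{C}$, $\mathcal{V}_2\mathcal{C}$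 is the class of finitely presented groups which have a subgroup of index at most $2$ belonging to $\mathcal{C}$. A closed 3-manifold is modelled on $S^2\times\mathbb{R}$ if it is a quotient of $S^2\times\mathbb{R}$ (with the product of the round metric and the standard metric) by a discrete group of isometries acting freely. **Theorem.** Let $\mathcal{SF}_{+,=}$ be the class of fundamental groups of closed 3-manifolds modelled on $S^2\times\mathbb{R}$. 1. $\mathcal{SF}_{+,=}$ is recursive modulo the word problem. 2. $\mathcal{SF}_{+,=}=\mathcal{V}_2\{\mathbb{Z}\}$. 3. $\mathcal{SF}_{+,=}=\{\mathbb{Z}\}\cup\{\mathbb{Z}\times\mathbb{Z}/2\}\cup\{\mathbb{Z}/2*\mathbb{Z}/2\}$. 4. For an arbitrary group $G$, the following are equivalent: $G$ is isomorphic to the fundamental group of a closed 3-manifold modelled on $S^2\times\mathbb{R}$; $G$ is isomorphic to one of $\mathbb{Z}$, $\mathbb{Z}\times\mathbb{Z}/2$, $\mathbb{Z}/2*\mathbb{Z}/2$; $G$ has an infinite cyclic subgroup of index at most $2$. -/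

import Mathlib

/-! ### Finite presentations over a fixed countable alphabet -/

/-- A word in the letters `0, 1, 2, …` and their formal inverses: `(i, true)` stands for the letter
`i` and `(i, false)` for its inverse. -/
abbrev Word : Type := List (ℕ × Bool)

/-- Raw data of a finite presentation over the countable alphabet `ℕ`: a finite list of generators
and a finite list of relators. -/
abbrev Presentation : Type := List ℕ × List Word

/-- The set `𝓤` of all finite presentations: every relator is a word in the listed generators. -/
def allPresentations : Set Presentation :=
  {P | ∀ r ∈ P.2, ∀ a ∈ r, a.1 ∈ P.1}

/-- The set of generators of a presentation, as a type. -/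
abbrev Generator (P : Presentation) : Type := {i : ℕ // i ∈ P.1}

/-- Spell out a word in the generators of `P` in the fixed alphabet. -/
def spell {P : Presentation} (w : List (Generator P × Bool)) : Word :=
  w.map fun a => (a.1.1, a.2)

/-- The relators of `P` as elements of the free group on the generators of `P`. -/
def relators (P : Presentation) : Set (FreeGroup (Generator P)) :=
  {g | ∃ w : List (Generator P × Bool), spell w ∈ P.2 ∧ g = FreeGroup.mk w}

/-- The group presented by `P`. -/
abbrev PresGroup (P : Presentation) : Type := PresentedGroup (relators P)

/-- The element of the group presented by `P` represented by a word in its generators. -/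
def wordValue (P : Presentation) (w : List (Generator P × Bool)) : PresGroup P :=
  PresentedGroup.mk (relators P) (FreeGroup.mk w)

/-! ### Recursiveness modulo the word problem -/

/-- A set of presentations is recursively enumerable. -/
def RecEnum (X : Set Presentation) : Prop :=
  X ⊆ allPresentations ∧ REPred fun P => P ∈ X

/-- Recursive separability of (disjoint) sets of presentations. -/
def RecSeparable (X Y : Set Presentation) : Prop :=
  ∃ X' Y' : Set Presentation, RecEnum X' ∧ RecEnum Y' ∧
    X ⊆ X' ∧ Y ∩ X' = ∅ ∧ Y ⊆ Y' ∧ X ∩ Y' = ∅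

/-- The subset `C` of `D` is recursive in `D`. -/
def IsRecursiveIn (C D : Set Presentation) : Prop :=
  RecSeparable C (D \ C)

/-- The word problem is uniformly solvable in `D`: one algorithm takes a presentation and a word,
and whenever the presentation `P` is in `D` and the word is a word in the generators of `P`, it
halts and decides whether the word represents the identity in the group presented by `P`.
(On other inputs it may fail to halt or give incorrect answers.) -/
def WordProblemUniformlySolvable (D : Set Presentation) : Prop :=
  ∃ f : Presentation × Word →. Bool, Partrec f ∧
    ∀ P ∈ D, ∀ w : List (Generator P × Bool),
      ∃ b ∈ f (P, spell w), (b = true ↔ wordValue P w = 1)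

/-- The class of groups `C` is recursive modulo the word problem. -/
def RecursiveModuloWordProblem (C : Set Presentation) : Prop :=
  ∀ D : Set Presentation, D ⊆ allPresentations → WordProblemUniformlySolvable D →
    IsRecursiveIn (C ∩ D) D

/-! ### Classes of groups -/

/-- The finite presentations of groups isomorphic to `G`: the singleton class of groups `{G}`. -/
def singletonClass (G : Type) [Group G] : Set Presentation :=
  {P | P ∈ allPresentations ∧ Nonempty (PresGroup P ≃* G)}

/-- `𝒮ₖ{P}`: the finite presentations of the subgroups of index at most `k` in the group presented
by `P`. -/
def subgroupsOfIndexLE (k : ℕ) (P : Presentation) : Set Presentation :=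
  {Q | Q ∈ allPresentations ∧ ∃ H : Subgroup (PresGroup P),
    H.index ≠ 0 ∧ H.index ≤ k ∧ Nonempty (PresGroup Q ≃* H)}

/-- `𝒱ₖC`: the finite presentations `P` such that some subgroup of index at most `k` of the group
presented by `P` lies in `C`. -/
def virtualClass (k : ℕ) (C : Set Presentation) : Set Presentation :=
  {P | P ∈ allPresentations ∧ (subgroupsOfIndexLE k P ∩ C).Nonempty}

/-! ### Closed manifolds modelled on `S² × ℝ` -/

/-- The space `S² × ℝ`, where `S²` is the unit sphere of Euclidean 3-space. -/
abbrev S2R : Type := Metric.sphere (0 : EuclideanSpace ℝ (Fin 3)) 1 × ℝ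

/-- The distance of the product Riemannian metric on `S² × ℝ`: the distance of two points of the
round unit sphere is the angle between them. -/
noncomputable def s2rDist (p q : S2R) : ℝ :=
  Real.sqrt (InnerProductGeometry.angle (p.1 : EuclideanSpace ℝ (Fin 3)) q.1 ^ 2
    + (p.2 - q.2) ^ 2)

/-- A homeomorphism of `S² × ℝ` that is an isometry. -/
def IsS2RIsometry (φ : S2R ≃ₜ S2R) : Prop :=
  ∀ p q : S2R, s2rDist (φ p) (φ q) = s2rDist p q

/-- `M` is a closed 3-manifold: a nonempty compact connected Hausdorff space that is locally
homeomorphic to Euclidean 3-space. -/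
structure IsClosedThreeManifold (M : Type) [TopologicalSpace M] : Prop where
  compact : CompactSpace M
  connected : ConnectedSpace M
  hausdorff : T2Space M
  locallyEuclidean : Nonempty (ChartedSpace (EuclideanSpace ℝ (Fin 3)) M)

/-- `M` is modelled on `S² × ℝ`: it has a (universal) covering by `S² × ℝ` all of whose deck
transformations are isometries. Equivalently `M` is the quotient of `S² × ℝ` by a discrete group of
isometries acting freely, i.e. `M` carries a Riemannian metric whose universal cover is isometric
to `S² × ℝ`: the covering is normal because `S² × ℝ` is simply connected, and there is only one
deck transformation that takes `p` to `q`. -/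
def IsModelledOnS2R (M : Type) [TopologicalSpace M] : Prop :=
  ∃ c : S2R → M, IsCoveringMap c ∧ Function.Surjective c ∧
    ∀ p q : S2R, c p = c q → ∃ φ : S2R ≃ₜ S2R, IsS2RIsometry φ ∧ (∀ x, c (φ x) = c x) ∧ φ p = q

/-- `G` is isomorphic to the fundamental group of a closed 3-manifold modelled on `S² × ℝ`. -/
def IsClosedS2RManifoldGroup (G : Type*) [Group G] : Prop :=
  ∃ (M : Type) (_ : TopologicalSpace M) (x : M),
    IsClosedThreeManifold M ∧ IsModelledOnS2R M ∧ Nonempty (G ≃* FundamentalGroup M x)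

/-- The class of groups `𝒮ℱ₊,₌`: all finite presentations of fundamental groups of closed
3-manifolds modelled on `S² × ℝ`. -/
def SFPlusEq : Set Presentation :=
  {P | P ∈ allPresentations ∧ IsClosedS2RManifoldGroup (PresGroup P)}

/-- The infinite cyclic group. -/
abbrev CycInf : Type := Multiplicative ℤ

/-- The cyclic group of order two. -/
abbrev CycTwo : Type := Multiplicative (ZMod 2)

/-! Manifold to group. Since `S² × ℝ` is simply connected, the fundamental group is the opposite of
the deck group. Every isometry splits as a linear isometry of the sphere times `s ↦ ± s + b`: the
angular displacement along the image of a vertical line doubles when the parameter doubles, yet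
angles are at most `π` (`ang_vertical_eq_zero`). The shifts `b` of the deck transformations with
sign `+` form a subgroup of `ℝ`. It is not dense because fibres are discrete, and nonzero because
the quotient is compact, so it is generated by the shift of some `t`. A nontrivial deck
transformation preserving a level is antipodal on it, because the square of a linear isometry of
3-space fixes a unit vector; hence each level has at most one such transformation
(`deck_eq_of_fixed_level`). A nontrivial transformation preserving all levels therefore excludes
reflections of `ℝ`, and in every case the powers of `t` have index at most two
(`isCyclicByTwo_deckGroup`).

Group to manifold. If `s` represents the other coset of the powers of `t`, then `s` commutes with
`t` or inverts it. The parity of the exponent of `s²` settles the first case, and `s² = 1` in the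
second. This leaves three groups, each acting freely on `S² × ℝ` by translations, possibly combined
with the antipodal map and with reflections of `ℝ`.

Recursiveness. Having an infinite cyclic subgroup of index at most two, and not having one, are both
witnessed by finite certificates that a solution of the word problem can check, so two searches
suffice. The positive certificate gives words `t`, `s` for which the cosets of `1` and `s` are
permuted by the letters, and a finite table defining an action on `ℤ × Bool` in which `t` is a
nonzero translation, hence of infinite order. A negative certificate is of one of three kinds: a
finite list exhausting the group; in every subgroup of index at most two, a noncommuting pair or an
involution; or a homomorphism to `ℤ`, on such a subgroup, that does not vanish but kills an element
with nontrivial square. They cover all cases: without the first two, some subgroup of index at most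
two is infinite, finitely generated, abelian and free of involutions, and it is not infinite cyclic.
-/

open Set Metric

/-! ### The sphere is simply connected -/

/-- Euclidean 3-space. -/
abbrev E3 : Type := EuclideanSpace ℝ (Fin 3)

/-- The unit sphere of Euclidean 3-space. -/
abbrev S2 : Type := Metric.sphere (0 : E3) 1

/-- The radial projection of a nonzero vector to the unit sphere. -/
noncomputable def radial (v : E3) (hv : v ≠ 0) : S2 :=
  ⟨‖v‖⁻¹ • v, by
    rw [mem_sphere_zero_iff_norm, norm_smul, norm_inv, norm_norm,
      inv_mul_cancel₀ (norm_ne_zero_iff.2 hv)]⟩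

theorem norm_S2 (x : S2) : ‖(x : E3)‖ = 1 := mem_sphere_zero_iff_norm.1 x.2

theorem continuous_radial {X : Type*} [TopologicalSpace X] {f : X → E3} (hf : Continuous f)
    (h : ∀ x, f x ≠ 0) : Continuous fun x => radial (f x) (h x) :=
  Continuous.subtype_mk ((hf.norm.inv₀ fun x => norm_ne_zero_iff.2 (h x)).smul hf) _

/-- At a zero the two summands have equal norms, which forces the midpoint, where the unit vectors
would be opposite. -/
theorem segment_ne_zero {x y : S2} (h : (x : E3) ≠ -y) (t : ℝ) :
    (1 - t) • (x : E3) + t • (y : E3) ≠ 0 := by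
  intro h0
  have h1 : (1 - t) • (x : E3) = -(t • (y : E3)) := eq_neg_of_add_eq_zero_left h0
  have h2 := congrArg norm h1
  rw [norm_neg, norm_smul, norm_smul, norm_S2, norm_S2, mul_one, mul_one, Real.norm_eq_abs,
    Real.norm_eq_abs] at h2
  rcases abs_eq_abs.1 h2 with h3 | h3
  · have ht : t = 1 / 2 := by linarith
    subst ht
    apply h
    have : (1 / 2 : ℝ) • (x : E3) = (1 / 2 : ℝ) • (-(y : E3)) := by
      rw [smul_neg, ← h1]; norm_num
    exact smul_right_injective E3 (by norm_num : (1 / 2 : ℝ) ≠ 0) this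
  · linarith

/-- The straight-line homotopy avoids the origin, so it can be projected radially to the sphere. -/
theorem homotopic_of_ne_neg {x y : S2} (γ δ : Path x y)
    (h : ∀ s, (γ s : E3) ≠ -(δ s : E3)) : γ.Homotopic δ := by
  refine ⟨{ toFun := fun p => radial ((1 - (p.1 : ℝ)) • (γ p.2 : E3) + (p.1 : ℝ) • (δ p.2 : E3))
              (segment_ne_zero (h p.2) _)
            continuous_toFun := ?_
            map_zero_left := ?_
            map_one_left := ?_
            prop' := ?_ }⟩
  · exact continuous_radial (by fun_prop) _
  · intro s
    apply Subtype.ext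
    simp [radial]
  · intro s
    apply Subtype.ext
    simp [radial]
  · intro t s hs
    have hs' : γ s = δ s := by
      rcases hs with rfl | hs
      · simp
      · rw [mem_singleton_iff] at hs
        subst hs
        simp
    apply Subtype.ext
    simp only [radial, ContinuousMap.coe_mk, Path.coe_toContinuousMap]
    rw [← hs', ← add_smul]
    simp

theorem norm_lt_one_of_coord {v : E3} (h : ∀ i, |v i| < 1 / 2) : ‖v‖ < 1 := by
  rw [EuclideanSpace.norm_eq, Real.sqrt_lt' one_pos, Fin.sum_univ_three]
  simp only [Real.norm_eq_abs, sq_abs]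
  have := fun i => abs_lt.1 (h i)
  nlinarith [this 0, this 1, this 2]

/-- A path on the sphere is uniformly approximated by the restriction of a smooth curve with the
same end points. -/
theorem exists_smooth_approx {x y : S2} (γ : Path x y) :
    ∃ q : ℝ → E3, ContDiff ℝ 1 q ∧ q 0 = x ∧ q 1 = y ∧
      ∀ s : unitInterval, ‖q s - (γ s : E3)‖ < 1 := by
  -- Restoring the end points adds a convex combination of two errors below 1/10, so each coordinate
  -- is off by less than 1/5, well within the 1/2 needed for norm below 1.
  have hc : ∀ i : Fin 3, ∃ p : Polynomial ℝ, ∀ s ∈ Icc (0 : ℝ) 1,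
      |p.eval s - (γ.extend s : E3) i| < 1 / 10 := fun i =>
    exists_polynomial_near_of_continuousOn 0 1 (fun s => (γ.extend s : E3) i)
      (by have := γ.continuous_extend; fun_prop) _ (by norm_num)
  choose p hp using hc
  set P : ℝ → E3 := fun s => WithLp.toLp 2 fun i => (p i).eval s with hP
  refine ⟨fun s => P s - (1 - s) • (P 0 - x) - s • (P 1 - y), ?_, by simp, by simp, ?_⟩
  · have : ContDiff ℝ 1 P := by
      rw [contDiff_euclidean]
      intro i
      simpa using (p i).contDiff_aeval (𝕜 := ℝ) 1
    fun_prop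
  · intro s
    apply norm_lt_one_of_coord
    intro i
    have h0 := abs_lt.1 (hp i 0 (by simp))
    have h1 := abs_lt.1 (hp i 1 (by simp))
    have hs := abs_lt.1 (hp i s s.2)
    rw [Path.extend_zero] at h0
    rw [Path.extend_one] at h1
    rw [Path.extend_apply _ s.2] at hs
    simp only [PiLp.sub_apply, PiLp.smul_apply, smul_eq_mul, hP]
    have s0 := s.2.1
    have s1 := s.2.2
    rw [abs_lt]
    constructor <;> nlinarith

/-- The cone over a `C¹` curve is the image of a `C¹` map from a plane to 3-space, so its complement
is dense. General position needs this smoothness: a merely continuous loop may fill the sphere. -/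
theorem exists_direction_avoiding {q : ℝ → E3} (hq : ContDiff ℝ 1 q) :
    ∃ v : S2, ∀ s r : ℝ, r • q s ≠ v := by
  have hd : Dense (range fun p : ℝ × ℝ => p.2 • q p.1)ᶜ :=
    ContDiff.dense_compl_range_of_finrank_lt_finrank (by fun_prop) (by simp)
  obtain ⟨v, hv⟩ := hd.nonempty
  have hv0 : v ≠ 0 := fun h => hv ⟨(0, 0), by simp [h]⟩
  refine ⟨radial v hv0, fun s r h => hv ⟨(s, ‖v‖ * r), ?_⟩⟩
  simp only [mul_smul, h, radial]
  rw [smul_inv_smul₀ (norm_ne_zero_iff.2 hv0)]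

theorem simplyConnectedSpace_compl_singleton (v : S2) :
    SimplyConnectedSpace ({v}ᶜ : Set S2) := by
  have e := (stereographic (norm_S2 v)).toHomeomorphSourceTarget
  rw [stereographic_source, stereographic_target] at e
  have := (e.trans (Homeomorph.Set.univ _)).contractibleSpace
  exact SimplyConnectedSpace.ofContractible _

theorem homotopic_of_avoid {x y : S2} (v : S2) (γ δ : Path x y) (hγ : ∀ s, γ s ≠ v)
    (hδ : ∀ s, δ s ≠ v) : γ.Homotopic δ := by
  have := simplyConnectedSpace_compl_singleton v
  let x' : ({v}ᶜ : Set S2) := ⟨x, by simpa using hγ 0⟩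
  let y' : ({v}ᶜ : Set S2) := ⟨y, by simpa using hγ 1⟩
  let lift : ∀ γ : Path x y, (∀ s, γ s ≠ v) → Path x' y' := fun γ hγ =>
    { toFun := fun s => ⟨γ s, hγ s⟩
      source' := Subtype.ext γ.source
      target' := Subtype.ext γ.target }
  exact (SimplyConnectedSpace.paths_homotopic (lift γ hγ) (lift δ hδ)).map
    ⟨Subtype.val, continuous_subtype_val⟩

instance simplyConnectedSpace_S2 : SimplyConnectedSpace S2 := by
  rw [simply_connected_iff_loops_nullhomotopic]
  constructor
  · exact isPathConnected_iff_pathConnectedSpace.1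
      (isPathConnected_sphere (by rw [← Module.finrank_eq_rank]; simp) _ zero_le_one)
  · intro x γ
    obtain ⟨q, hq, q0, q1, hqγ⟩ := exists_smooth_approx γ
    have hne : ∀ s : unitInterval, q s ≠ 0 := by
      intro s h
      have := hqγ s
      rw [h, zero_sub, norm_neg, norm_S2] at this
      exact lt_irrefl _ this
    let δ : Path x x :=
      { toFun := fun s => radial (q s) (hne s)
        continuous_toFun := continuous_radial (hq.continuous.comp continuous_subtype_val) hne
        source' := by apply Subtype.ext; simp [radial, q0]
        target' := by apply Subtype.ext; simp [radial, q1] }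
    have hδ : ∀ s, (δ s : E3) = ‖q s‖⁻¹ • q s := fun s => rfl
    have h1 : γ.Homotopic δ := by
      apply homotopic_of_ne_neg
      intro s h
      -- If `γ s` were opposite to the direction of `q s`, their distance would be `‖q s‖ + 1`,
      -- contradicting the bound 1.
      have h2 : q s - (γ s : E3) = (1 + ‖q s‖⁻¹) • q s := by
        rw [h, hδ]; module
      have h3 := hqγ s
      rw [h2, norm_smul, Real.norm_of_nonneg (by positivity), add_mul,
        inv_mul_cancel₀ (norm_ne_zero_iff.2 (hne s))] at h3
      linarith [norm_nonneg (q s)]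
    obtain ⟨v, hv⟩ := exists_direction_avoiding hq
    have hδv : ∀ s, δ s ≠ v := fun s h => hv s ‖q s‖⁻¹ (by rw [← h]; rfl)
    refine h1.trans (homotopic_of_avoid v δ _ hδv ?_)
    intro s
    have := hδv 0
    rwa [δ.source] at this

instance simplyConnectedSpace_S2R : SimplyConnectedSpace S2R :=
  ((ContinuousMap.HomotopyEquiv.refl S2).prodCongr
    (ContractibleSpace.hequiv ℝ Unit).some |>.trans
      (Homeomorph.prodPUnit S2).toHomotopyEquiv).simplyConnectedSpace

/-! ### Isometries of `S² × ℝ` -/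

/-- The angular distance on the unit sphere. -/
noncomputable abbrev ang (x y : S2) : ℝ := InnerProductGeometry.angle (x : E3) y

theorem ang_self (x : S2) : ang x x = 0 := by
  apply InnerProductGeometry.angle_self
  rw [← norm_ne_zero_iff, norm_S2]; exact one_ne_zero

theorem inner_eq_cos_ang (x y : S2) : inner ℝ (x : E3) (y : E3) = Real.cos (ang x y) := by
  rw [InnerProductGeometry.cos_angle, norm_S2, norm_S2]; simp

theorem eq_of_ang_eq_zero {x y : S2} (h : ang x y = 0) : x = y := by
  apply Subtype.ext
  rw [← inner_eq_one_iff_of_norm_eq_one (𝕜 := ℝ) (norm_S2 x) (norm_S2 y), inner_eq_cos_ang, h,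
    Real.cos_zero]

theorem s2r_isometry_sq {φ : S2R ≃ₜ S2R} (hφ : IsS2RIsometry φ) (p q : S2R) :
    ang (φ p).1 (φ q).1 ^ 2 + ((φ p).2 - (φ q).2) ^ 2 = ang p.1 q.1 ^ 2 + (p.2 - q.2) ^ 2 :=
  (Real.sqrt_inj (by positivity) (by positivity)).1 (hφ p q)

theorem IsS2RIsometry.symm {φ : S2R ≃ₜ S2R} (hφ : IsS2RIsometry φ) : IsS2RIsometry φ.symm := by
  intro p q
  rw [← hφ (φ.symm p) (φ.symm q), φ.apply_symm_apply, φ.apply_symm_apply]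

/-- On the image of a vertical line, doubling the parameter doubles the angular displacement. -/
theorem ang_vertical_double {φ : S2R ≃ₜ S2R} (hφ : IsS2RIsometry φ) (x : S2) (s h : ℝ) :
    ang (φ (x, s)).1 (φ (x, s + 2 * h)).1 = 2 * ang (φ (x, s)).1 (φ (x, s + h)).1 := by
  have h1 := s2r_isometry_sq hφ (x, s) (x, s + h)
  have h2 := s2r_isometry_sq hφ (x, s + h) (x, s + 2 * h)
  have h3 := s2r_isometry_sq hφ (x, s) (x, s + 2 * h)
  have tri := InnerProductGeometry.angle_le_angle_add_angle ((φ (x, s)).1 : E3)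
    (φ (x, s + h)).1 (φ (x, s + 2 * h)).1
  simp only [ang_self] at h1 h2 h3
  have n1 : 0 ≤ ang (φ (x, s)).1 (φ (x, s + h)).1 := InnerProductGeometry.angle_nonneg _ _
  have n2 : 0 ≤ ang (φ (x, s + h)).1 (φ (x, s + 2 * h)).1 := InnerProductGeometry.angle_nonneg _ _
  have n3 : 0 ≤ ang (φ (x, s)).1 (φ (x, s + 2 * h)).1 := InnerProductGeometry.angle_nonneg _ _
  change ang _ _ ≤ ang _ _ + ang _ _ at tri
  generalize ang (φ (x, s)).1 (φ (x, s + h)).1 = a at *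
  generalize ang (φ (x, s + h)).1 (φ (x, s + 2 * h)).1 = b at *
  generalize ang (φ (x, s)).1 (φ (x, s + 2 * h)).1 = c at *
  generalize (φ (x, s)).2 = u at *
  generalize (φ (x, s + h)).2 = v at *
  generalize (φ (x, s + 2 * h)).2 = w at *
  have hc : c ^ 2 ≤ (a + b) ^ 2 := pow_le_pow_left₀ n3 tri 2
  -- The plane vectors `(a, u - v)` and `(b, v - w)` both have length `|h|`, and by the triangle
  -- inequality for angles their sum has length at least `2|h|`. The parallelogram identity makes
  -- them equal.
  have key : (a - b) ^ 2 + ((u - v) - (v - w)) ^ 2 ≤ 0 := by nlinarith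
  have e1 : a - b = 0 := by
    apply pow_eq_zero_iff two_ne_zero |>.1
    nlinarith [sq_nonneg (a - b), sq_nonneg ((u - v) - (v - w))]
  have e2 : (u - v) - (v - w) = 0 := by
    apply pow_eq_zero_iff two_ne_zero |>.1
    nlinarith [sq_nonneg (a - b), sq_nonneg ((u - v) - (v - w))]
  have e3 : w = 2 * v - u := by linarith
  subst e3
  have : c ^ 2 = (2 * a) ^ 2 := by nlinarith
  exact (pow_left_inj₀ n3 (by positivity) two_ne_zero).1 this

/-- A nonzero angular displacement would grow like `2 ^ n` under repeated doubling and exceed `π`.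
-/
theorem ang_vertical_eq_zero {φ : S2R ≃ₜ S2R} (hφ : IsS2RIsometry φ) (x : S2) (s h : ℝ) :
    ang (φ (x, s)).1 (φ (x, s + h)).1 = 0 := by
  have hp : ∀ n : ℕ, ang (φ (x, s)).1 (φ (x, s + 2 ^ n * h)).1
      = 2 ^ n * ang (φ (x, s)).1 (φ (x, s + h)).1 := by
    intro n
    induction n with
    | zero => simp
    | succ n ih =>
      rw [show (2 : ℝ) ^ (n + 1) * h = 2 * (2 ^ n * h) by ring, ang_vertical_double hφ, ih]
      ring
  by_contra hne
  have hpos : 0 < ang (φ (x, s)).1 (φ (x, s + h)).1 :=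
    lt_of_le_of_ne (InnerProductGeometry.angle_nonneg _ _) (Ne.symm hne)
  obtain ⟨n, hn⟩ := pow_unbounded_of_one_lt (Real.pi / ang (φ (x, s)).1 (φ (x, s + h)).1)
    (one_lt_two)
  rw [div_lt_iff₀ hpos, ← hp] at hn
  exact absurd (InnerProductGeometry.angle_le_pi _ _) (not_le.2 hn)

theorem fst_vertical {φ : S2R ≃ₜ S2R} (hφ : IsS2RIsometry φ) (x : S2) (s t : ℝ) :
    (φ (x, s)).1 = (φ (x, t)).1 := by
  apply eq_of_ang_eq_zero
  have := ang_vertical_eq_zero hφ x s (t - s)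
  rwa [add_sub_cancel] at this

/-- The inverse isometry also maps vertical lines into vertical lines, so the image of a vertical
line is a whole line. -/
theorem exists_snd_vertical {φ : S2R ≃ₜ S2R} (hφ : IsS2RIsometry φ) (x : S2) (t : ℝ) :
    ∃ s, (φ (x, s)).2 = t := by
  refine ⟨(φ.symm ((φ (x, 0)).1, t)).2, ?_⟩
  have h1 : (φ.symm ((φ (x, 0)).1, t)).1 = x := by
    rw [fst_vertical hφ.symm _ t (φ (x, 0)).2, Prod.mk.eta, φ.symm_apply_apply]
  have h2 : φ (x, (φ.symm ((φ (x, 0)).1, t)).2) = ((φ (x, 0)).1, t) := by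
    have h3 : (x, (φ.symm ((φ (x, 0)).1, t)).2) = φ.symm ((φ (x, 0)).1, t) :=
      Prod.ext h1.symm rfl
    rw [h3, φ.apply_symm_apply]
  rw [h2]

/-- Two comparisons. Points at equal height have images whose angle is at most the original one.
Choosing instead the point over `y` whose image has the height of the image of `(x, s)` gives the
reverse inequality. -/
theorem ang_fst_eq {φ : S2R ≃ₜ S2R} (hφ : IsS2RIsometry φ) (x y : S2) (s t : ℝ) :
    ang (φ (x, s)).1 (φ (y, t)).1 = ang x y := by
  rw [fst_vertical hφ y t s]
  have n1 : 0 ≤ ang (φ (x, s)).1 (φ (y, s)).1 := InnerProductGeometry.angle_nonneg _ _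
  have n2 : 0 ≤ ang x y := InnerProductGeometry.angle_nonneg _ _
  obtain ⟨r, hr⟩ := exists_snd_vertical hφ y (φ (x, s)).2
  have h1 := s2r_isometry_sq hφ (x, s) (y, s)
  have h2 := s2r_isometry_sq hφ (x, s) (y, r)
  rw [hr, fst_vertical hφ y r s] at h2
  simp only [sub_self] at h1 h2
  apply (pow_left_inj₀ n1 n2 two_ne_zero).1
  nlinarith [sq_nonneg ((φ (x, s)).2 - (φ (y, s)).2), sq_nonneg (s - r)]

theorem snd_sub_sq {φ : S2R ≃ₜ S2R} (hφ : IsS2RIsometry φ) (x y : S2) (s t : ℝ) :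
    ((φ (x, s)).2 - (φ (y, t)).2) ^ 2 = (s - t) ^ 2 := by
  have h1 := s2r_isometry_sq hφ (x, s) (y, t)
  rw [ang_fst_eq hφ] at h1
  linarith

/-- An angle preserving self-map of the unit sphere is the restriction of a linear isometry. -/
theorem exists_linearIsometryEquiv {A : S2 → S2} (hA : ∀ x y, ang (A x) (A y) = ang x y) :
    ∃ L : E3 ≃ₗᵢ[ℝ] E3, ∀ x, (A x : E3) = L x := by
  have hin : ∀ x y, inner ℝ (A x : E3) (A y : E3) = inner ℝ (x : E3) (y : E3) := fun x y => by
    rw [inner_eq_cos_ang, inner_eq_cos_ang, hA]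
  let e := EuclideanSpace.basisFun (Fin 3) ℝ
  let v : Fin 3 → S2 := fun i => ⟨e i, mem_sphere_zero_iff_norm.2 (e.norm_eq_one i)⟩
  have hon : Orthonormal ℝ fun i => (A (v i) : E3) := by
    rw [orthonormal_iff_ite]
    intro i j
    rw [hin]
    exact orthonormal_iff_ite.1 e.orthonormal i j
  have hs : ⊤ ≤ Submodule.span ℝ (range fun i => (A (v i) : E3)) :=
    (hon.linearIndependent.span_eq_top_of_card_eq_finrank (by simp)).ge
  let f := OrthonormalBasis.mk hon hs
  have hf : ∀ i, f i = A (v i) := fun i => by simp [f]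
  refine ⟨e.equiv f (Equiv.refl _), fun x => ?_⟩
  apply InnerProductSpace.ext_inner_left_basis f.toBasis
  intro i
  have : f.toBasis i = e.equiv f (Equiv.refl _) (e i) := by simp
  rw [this, LinearIsometryEquiv.inner_map_map]
  have h2 : e.equiv f (Equiv.refl _) (e i) = A (v i) := by rw [← this]; simp [hf]
  rw [h2, hin]

/-- Subtracting the relations for `(s, 0)` and `(s, 1)` gives `(u 1 - u 0) * (u s - u 0) = s`, and
the first factor is its own inverse. -/
theorem exists_affine_of_sub_sq {u : ℝ → ℝ} (hu : ∀ s t, (u s - u t) ^ 2 = (s - t) ^ 2) :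
    ∃ ε b : ℝ, (ε = 1 ∨ ε = -1) ∧ ∀ s, u s = ε * s + b := by
  refine ⟨u 1 - u 0, u 0, ?_, fun s => ?_⟩
  · have := hu 1 0
    rw [sub_zero, one_pow] at this
    exact sq_eq_one_iff.1 this
  · have h1 := hu 1 0
    have h2 := hu s 0
    have h3 := hu s 1
    nlinarith

/-- The isometry `φ` is the product of the linear isometry `L` and the map `s ↦ ε s + b`. -/
structure IsProductMap (φ : S2R ≃ₜ S2R) (L : E3 ≃ₗᵢ[ℝ] E3) (ε b : ℝ) : Prop where
  sign : ε = 1 ∨ ε = -1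
  fst : ∀ p : S2R, ((φ p).1 : E3) = L p.1
  snd : ∀ p : S2R, (φ p).2 = ε * p.2 + b

/-- The angular part does not depend on the height. The height part does not depend on the point of
the sphere, since points at equal height have images at equal height. -/
theorem IsS2RIsometry.exists_isProductMap {φ : S2R ≃ₜ S2R} (hφ : IsS2RIsometry φ) :
    ∃ L ε b, IsProductMap φ L ε b := by
  obtain ⟨L, hL⟩ := exists_linearIsometryEquiv (A := fun x => (φ (x, 0)).1)
    fun x y => ang_fst_eq hφ x y 0 0
  obtain ⟨x₀⟩ : Nonempty S2 := inferInstance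
  obtain ⟨ε, b, hε, hb⟩ := exists_affine_of_sub_sq (u := fun s => (φ (x₀, s)).2)
    fun s t => snd_sub_sq hφ x₀ x₀ s t
  refine ⟨L, ε, b, hε, fun p => ?_, fun p => ?_⟩
  · rw [← hL, ← fst_vertical hφ p.1 p.2 0]
  · have := snd_sub_sq hφ p.1 x₀ p.2 p.2
    rw [sub_self, zero_pow two_ne_zero, pow_eq_zero_iff two_ne_zero, sub_eq_zero] at this
    rw [← hb, ← this]

/-! ### Fixed vectors of linear isometries of Euclidean 3-space -/

theorem exists_root_of_odd_natDegree {p : Polynomial ℝ} (hm : p.Monic) (hd : Odd p.natDegree) :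
    ∃ x, p.IsRoot x := by
  have hdeg : 0 < p.degree := Polynomial.natDegree_pos_iff_degree_pos.1 hd.pos
  have h1 : Filter.Tendsto (fun x => p.eval x) Filter.atTop Filter.atTop :=
    p.tendsto_atTop_of_leadingCoeff_nonneg hdeg (by rw [hm]; exact zero_le_one)
  have h2 : Filter.Tendsto (fun x => (p.comp (-Polynomial.X)).eval x) Filter.atTop Filter.atBot := by
    apply Polynomial.tendsto_atBot_of_leadingCoeff_nonpos
    · rw [← Polynomial.natDegree_pos_iff_degree_pos, Polynomial.natDegree_comp]
      simpa using hd.pos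
    · rw [Polynomial.leadingCoeff_comp (by simp), hm]
      simp [hd.neg_one_pow]
  obtain ⟨a, ha⟩ := (h1.eventually_ge_atTop 0).exists
  obtain ⟨b, hb⟩ := (h2.eventually_le_atBot 0).exists
  rw [Polynomial.eval_comp] at hb
  exact mem_range_of_exists_le_of_exists_ge p.continuous ⟨_, hb⟩ ⟨_, ha⟩

/-- The square of a linear isometry of Euclidean 3-space fixes a unit vector. -/
theorem exists_fixed_sq (L : E3 ≃ₗᵢ[ℝ] E3) : ∃ v : S2, L (L v) = v := by
  -- The characteristic polynomial has degree 3, hence a real root; an eigenvalue of an isometry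
  -- satisfies `r * r = 1`.
  obtain ⟨r, hr⟩ := exists_root_of_odd_natDegree
    (p := (L.toLinearEquiv : E3 →ₗ[ℝ] E3).charpoly) (LinearMap.charpoly_monic _) (by
      rw [LinearMap.charpoly_natDegree]; simp; decide)
  obtain ⟨v, hv⟩ := ((Module.End.hasEigenvalue_iff_isRoot_charpoly _ _).2 hr).exists_hasEigenvector
  have hv1 : L v = r • v := hv.apply_eq_smul
  have hr2 : r * r = 1 := by
    have := congrArg norm hv1
    rw [L.norm_map, norm_smul] at this
    have h1 : ‖r‖ = 1 := by
      have := norm_ne_zero_iff.2 hv.2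
      field_simp at *
      linarith
    rw [← abs_mul_abs_self r, ← Real.norm_eq_abs, h1, mul_one]
  refine ⟨radial v hv.2, ?_⟩
  simp only [radial, map_smul, hv1, smul_smul]
  rw [show ‖v‖⁻¹ * r * r = ‖v‖⁻¹ * (r * r) by ring, hr2, mul_one]

/-- The vector `L v + v` is fixed by `L`; if it were nonzero, normalising it would give a fixed unit
vector. -/
theorem eq_neg_of_sq_eq_one {L : E3 ≃ₗᵢ[ℝ] E3} (h2 : ∀ v : S2, L (L v) = v)
    (hfix : ∀ v : S2, L v ≠ v) (v : S2) : L v = -v := by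
  by_contra h
  have h0 : L v + v ≠ 0 := fun h' => h (eq_neg_of_add_eq_zero_left h')
  apply hfix (radial _ h0)
  simp only [radial, map_smul, map_add, h2]
  rw [add_comm]

/-! ### Infinite cyclic subgroups of index at most two -/

/-- `G` has an infinite cyclic subgroup of index at most two. -/
def IsCyclicByTwo (G : Type*) [Group G] : Prop :=
  ∃ H : Subgroup G, H.index ≠ 0 ∧ H.index ≤ 2 ∧ Nonempty (H ≃* CycInf)

/-- The covering condition treats index one and index two uniformly: `s` may lie in `H`. -/
theorem index_le_two_of_cosets {G : Type*} [Group G] {H : Subgroup G} (s : G)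
    (hs : ∀ g, g ∈ H ∨ s⁻¹ * g ∈ H) : H.index ≠ 0 ∧ H.index ≤ 2 := by
  let f : Bool → G ⧸ H := fun e => if e then ((1 : G) : G ⧸ H) else (s : G ⧸ H)
  have hf : Function.Surjective f := by
    intro q
    induction q using QuotientGroup.induction_on with
    | H g =>
      rcases hs g with h | h
      · exact ⟨true, by simpa [f, QuotientGroup.eq] using h⟩
      · exact ⟨false, by simpa [f, QuotientGroup.eq] using h⟩
  have : Finite (G ⧸ H) := Finite.of_surjective f hf
  have h2 := Nat.card_le_card_of_surjective f hf
  rw [Nat.card_eq_fintype_card (α := Bool), Fintype.card_bool] at h2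
  exact ⟨Nat.card_pos.ne', h2⟩

theorem exists_coset_rep_of_index_le_two {G : Type*} [Group G] {H : Subgroup G}
    (h0 : H.index ≠ 0) (h2 : H.index ≤ 2) : ∃ s, ∀ g, g ∈ H ∨ s⁻¹ * g ∈ H := by
  by_cases h1 : H.index = 1
  · rw [Subgroup.index_eq_one] at h1
    exact ⟨1, fun g => by simp [h1]⟩
  · have h : H.index = 2 := by omega
    obtain ⟨a, ha⟩ := Subgroup.index_eq_two_iff'.1 h
    refine ⟨a⁻¹, fun g => ?_⟩
    rw [inv_inv]
    exact (ha g).or.symm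

theorem nonempty_zpowers_equiv {G : Type*} [Group G] {t : G} (ht : ∀ n : ℤ, t ^ n = 1 → n = 0) :
    Nonempty (Subgroup.zpowers t ≃* CycInf) := by
  have hinj : Function.Injective (zpowersHom G t) := by
    rw [injective_iff_map_eq_one]
    intro n hn
    exact ht _ hn
  exact ⟨(MonoidHom.ofInjective hinj).symm⟩

/-! ### The deck group -/

/-- The isometric deck transformations of a map defined on `S² × ℝ`. -/
def deckGroup {M : Type*} (c : S2R → M) : Subgroup (S2R ≃ₜ S2R) where
  carrier := {φ | IsS2RIsometry φ ∧ ∀ x, c (φ x) = c x}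
  one_mem' := ⟨fun _ _ => rfl, fun _ => rfl⟩
  mul_mem' := fun {φ ψ} hφ hψ => ⟨fun p q => (hφ.1 _ _).trans (hψ.1 _ _),
    fun x => (hφ.2 _).trans (hψ.2 x)⟩
  inv_mem' := fun {φ} hφ => ⟨hφ.1.symm, fun x => by
    rw [← hφ.2, Homeomorph.inv_apply, φ.apply_symm_apply]⟩

instance deckAction {M : Type*} (c : S2R → M) : MulAction (deckGroup c) S2R where
  smul g p := g.1 p
  one_smul _ := rfl
  mul_smul _ _ _ := rfl

section deck

variable {M : Type*} {c : S2R → M}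

theorem deck_isProductMap (g : deckGroup c) : ∃ L ε b, IsProductMap g.1 L ε b :=
  g.2.1.exists_isProductMap

/-- The linear part of a deck transformation. -/
noncomputable def deckLin (g : deckGroup c) : E3 ≃ₗᵢ[ℝ] E3 := (deck_isProductMap g).choose

/-- The orientation of a deck transformation on the factor `ℝ`. -/
noncomputable def deckSign (g : deckGroup c) : ℝ := (deck_isProductMap g).choose_spec.choose

/-- The translation part of a deck transformation on the factor `ℝ`. -/
noncomputable def deckShift (g : deckGroup c) : ℝ :=
  (deck_isProductMap g).choose_spec.choose_spec.choose

theorem deck_spec (g : deckGroup c) : IsProductMap g.1 (deckLin g) (deckSign g) (deckShift g) :=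
  (deck_isProductMap g).choose_spec.choose_spec.choose_spec

theorem deck_smul_fst (g : deckGroup c) (p : S2R) : ((g • p).1 : E3) = deckLin g p.1 :=
  (deck_spec g).fst p

theorem deck_smul_snd (g : deckGroup c) (p : S2R) :
    (g • p).2 = deckSign g * p.2 + deckShift g :=
  (deck_spec g).snd p

/-- A point of the unit sphere. -/
noncomputable def basePoint : S2 := Classical.arbitrary S2

/-- The product decomposition is obtained by choice. Evaluation at a base point shows that shift and
sign are determined by the map, which gives their composition laws. -/
theorem deckShift_eq (g : deckGroup c) : deckShift g = (g • ((basePoint, 0) : S2R)).2 := by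
  rw [deck_smul_snd]; simp

theorem deckSign_eq (g : deckGroup c) : deckSign g =
    (g • ((basePoint, 1) : S2R)).2 - (g • ((basePoint, 0) : S2R)).2 := by
  rw [deck_smul_snd, deck_smul_snd]; simp

theorem deckShift_one : deckShift (1 : deckGroup c) = 0 := by rw [deckShift_eq, one_smul]

theorem deckSign_one : deckSign (1 : deckGroup c) = 1 := by
  rw [deckSign_eq, one_smul, one_smul]; simp

theorem deckShift_mul (g h : deckGroup c) :
    deckShift (g * h) = deckSign g * deckShift h + deckShift g := by
  rw [deckShift_eq, mul_smul, deck_smul_snd, deck_smul_snd]; simp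

theorem deckSign_mul (g h : deckGroup c) : deckSign (g * h) = deckSign g * deckSign h := by
  rw [deckSign_eq, mul_smul, mul_smul, deck_smul_snd, deck_smul_snd, deck_smul_snd g (h • _),
    deck_smul_snd h]
  ring

theorem deckSign_inv (g : deckGroup c) : deckSign g⁻¹ = deckSign g := by
  have h := deckSign_mul g g⁻¹
  rw [mul_inv_cancel, deckSign_one] at h
  rcases (deck_spec g).sign with h1 | h1 <;> rw [h1] at h ⊢ <;> linarith

theorem deckShift_inv {g : deckGroup c} (hg : deckSign g = 1) : deckShift g⁻¹ = -deckShift g := by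
  have h := deckShift_mul g g⁻¹
  rw [mul_inv_cancel, deckShift_one, hg] at h
  linarith

theorem deckSign_zpow {g : deckGroup c} (hg : deckSign g = 1) (n : ℤ) : deckSign (g ^ n) = 1 := by
  induction n using Int.induction_on with
  | zero => rw [zpow_zero, deckSign_one]
  | succ n ih => rw [zpow_add_one, deckSign_mul, ih, hg, one_mul]
  | pred n ih => rw [zpow_sub_one, deckSign_mul, ih, deckSign_inv, hg, one_mul]

theorem deckShift_zpow {g : deckGroup c} (hg : deckSign g = 1) (n : ℤ) :
    deckShift (g ^ n) = n * deckShift g := by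
  induction n using Int.induction_on with
  | zero => simp [deckShift_one]
  | succ n ih => rw [zpow_add_one, deckShift_mul, ih, deckSign_zpow hg]; push_cast; ring
  | pred n ih =>
    rw [zpow_sub_one, deckShift_mul, ih, deckSign_zpow hg, deckShift_inv hg]; push_cast; ring

variable [TopologicalSpace M]

/-- Uniqueness of lifts: the transformation and the identity both lift `c` and agree at `p`. -/
theorem deck_eq_one_of_fixed (hc : IsCoveringMap c) {g : deckGroup c} {p : S2R}
    (h : g • p = p) : g = 1 := by
  have := hc.eq_of_comp_eq g.1.continuous continuous_id (funext fun x => g.2.2 x) p h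
  exact Subtype.ext (Homeomorph.ext fun x => congrFun this x)

theorem isQuotientCoveringMap_deckGroup (hc : IsCoveringMap c) (hs : Function.Surjective c)
    (ht : ∀ p q : S2R, c p = c q → ∃ φ : S2R ≃ₜ S2R, IsS2RIsometry φ ∧ (∀ x, c (φ x) = c x) ∧
      φ p = q) : IsQuotientCoveringMap c (deckGroup c) where
  toIsQuotientMap := hc.isQuotientMap hs
  continuous_const_smul g := g.1.continuous
  apply_eq_iff_mem_orbit {p q} := by
    constructor
    · intro h
      obtain ⟨φ, h1, h2, h3⟩ := ht q p h.symm
      exact ⟨⟨φ, h1, h2⟩, h3⟩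
    · rintro ⟨g, rfl⟩
      exact g.2.2 q
  disjoint p := by
    -- If `x` and `g • x` both lie in a set on which `c` is injective, they coincide, and then `g =
    -- 1`.
    obtain ⟨U, hUo, hpU, hU⟩ := hc.isLocalHomeomorph.isLocallyInjective p
    refine ⟨U, hUo.mem_nhds hpU, ?_⟩
    rintro g ⟨_, ⟨x, hx, rfl⟩, hgx⟩
    exact deck_eq_one_of_fixed hc (hU hgx hx (g.2.2 x))

/-- A nontrivial deck transformation that is involutive on the factor `ℝ` is involutive, and it
fixes a point on the factor `ℝ` only if it is antipodal on the sphere. -/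
theorem deck_fst_eq_neg (hc : IsCoveringMap c) {g : deckGroup c} (hg : g ≠ 1) {s : ℝ}
    (hs : deckSign g * s + deckShift g = s) (v : S2) : (g • ((v, s) : S2R)).1 = -v := by
  have hs' : ∀ v : S2, (g • ((v, s) : S2R)).2 = s := fun v => by rw [deck_smul_snd]; exact hs
  -- The square of `g` fixes the point `(w, s)`, hence is trivial; so the linear part of `g` is an
  -- involution of the sphere without fixed points.
  obtain ⟨w, hw⟩ := exists_fixed_sq (deckLin g)
  have hgg : g * g = 1 := by
    apply deck_eq_one_of_fixed hc (p := (w, s))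
    refine Prod.ext (Subtype.ext ?_) ?_
    · rw [mul_smul, deck_smul_fst, deck_smul_fst, hw]
    · rw [mul_smul, deck_smul_snd, hs', hs]
  apply Subtype.ext
  rw [deck_smul_fst]
  apply eq_neg_of_sq_eq_one
  · intro x
    have := congrArg (fun q : S2R => (q.1 : E3)) (mul_smul g g ((x, s) : S2R))
    simp only [hgg, one_smul, deck_smul_fst] at this
    exact this.symm
  · intro x hx
    apply hg
    apply deck_eq_one_of_fixed hc (p := (x, s))
    refine Prod.ext (Subtype.ext ?_) (hs' x)
    rw [deck_smul_fst, hx]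

/-- Both act as the antipodal map on the level `s`, so `g⁻¹ * h` has a fixed point. -/
theorem deck_eq_of_fixed_level (hc : IsCoveringMap c) {g h : deckGroup c} (hg : g ≠ 1)
    (hh : h ≠ 1) {s : ℝ} (hgs : deckSign g * s + deckShift g = s)
    (hhs : deckSign h * s + deckShift h = s) : g = h := by
  have h1 : g • ((basePoint, s) : S2R) = h • ((basePoint, s) : S2R) := by
    refine Prod.ext ?_ ?_
    · rw [deck_fst_eq_neg hc hg hgs, deck_fst_eq_neg hc hh hhs]
    · rw [deck_smul_snd, deck_smul_snd]
      exact hgs.trans hhs.symm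
  rw [← inv_mul_eq_one]
  apply deck_eq_one_of_fixed hc (p := (basePoint, s))
  rw [mul_smul, ← h1, inv_smul_smul]

/-- The group of translation lengths of the orientation preserving deck transformations. -/
noncomputable def shiftGroup (c : S2R → M) : AddSubgroup ℝ where
  carrier := {a | ∃ g : deckGroup c, deckSign g = 1 ∧ deckShift g = a}
  zero_mem' := ⟨1, deckSign_one, deckShift_one⟩
  add_mem' := by
    rintro _ _ ⟨g, hg, rfl⟩ ⟨h, hh, rfl⟩
    exact ⟨g * h, by rw [deckSign_mul, hg, hh, one_mul], by rw [deckShift_mul, hg]; ring⟩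
  neg_mem' := by
    rintro _ ⟨g, hg, rfl⟩
    exact ⟨g⁻¹, by rw [deckSign_inv, hg], deckShift_inv hg⟩

/-- The fibre through the base point is closed and discrete, so it has only finitely many heights in
the unit interval. A dense set of shifts would produce a further one. -/
theorem not_dense_shiftGroup [T1Space M] (hc : IsCoveringMap c) :
    ¬ Dense (shiftGroup c : Set ℝ) := by
  intro hd
  let p₀ : S2R := (basePoint, 0)
  let F : Set S2R := c ⁻¹' {c p₀} ∩ univ ×ˢ Icc (0 : ℝ) 1
  have hFc : IsCompact F :=
    (isCompact_univ.prod isCompact_Icc).inter_left (isClosed_singleton.preimage hc.continuous)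
  have : DiscreteTopology (c ⁻¹' {c p₀}) := (hc (c p₀)).discreteTopology_fiber
  have hFd : DiscreteTopology F := DiscreteTopology.of_subset this inter_subset_left
  have hFf : F.Finite := hFc.finite (isDiscrete_iff_discreteTopology.2 hFd)
  have hS : (Prod.snd '' F).Finite := hFf.image _
  have hne : (Ioo (0 : ℝ) 1 \ (Prod.snd '' F)).Nonempty :=
    ((Ioo_infinite one_pos).sdiff hS).nonempty
  obtain ⟨a, ⟨ha, haF⟩, g, hg, rfl⟩ :=
    hd.inter_open_nonempty _ (isOpen_Ioo.sdiff hS.isClosed) hne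
  refine haF ⟨g • p₀, ⟨g.2.2 p₀, mem_univ _, ?_⟩, (deckShift_eq g).symm⟩
  rw [← deckShift_eq g]
  exact Ioo_subset_Icc_self ha

/-- Otherwise the distance to a suitable level is invariant and descends to a continuous unbounded
function on the compact quotient. -/
theorem exists_deckShift_ne_zero [CompactSpace M] (hq : IsQuotientCoveringMap c (deckGroup c)) :
    ∃ g : deckGroup c, deckSign g = 1 ∧ deckShift g ≠ 0 := by
  by_contra! H
  -- The product of two reflections has sign `+`, hence shift zero by assumption, so all reflections
  -- have the same shift and share the fixed level `deckShift r / 2`. Without reflections any level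
  -- serves.
  obtain ⟨s₀, hs₀⟩ : ∃ s₀ : ℝ, ∀ g : deckGroup c, ∀ s : ℝ,
      |deckSign g * s + deckShift g - s₀| = |s - s₀| := by
    by_cases hr : ∃ r : deckGroup c, deckSign r = -1
    · obtain ⟨r, hr⟩ := hr
      refine ⟨deckShift r / 2, fun g s => ?_⟩
      rcases (deck_spec g).sign with h | h
      · rw [h, H g h]; simp
      · have := H (r * g) (by rw [deckSign_mul, hr, h]; norm_num)
        rw [deckShift_mul, hr] at this
        have h2 : deckShift g = deckShift r := by linarith
        rw [h, h2, ← abs_neg]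
        congr 1; ring
    · refine ⟨0, fun g s => ?_⟩
      rcases (deck_spec g).sign with h | h
      · rw [h, H g h]; simp
      · exact absurd ⟨g, h⟩ hr
  let f : C(S2R, ℝ) := ⟨fun p => |p.2 - s₀|, by fun_prop⟩
  have hf : ∀ p q, c p = c q → f p = f q := by
    intro p q h
    obtain ⟨g, rfl⟩ := hq.apply_eq_iff_mem_orbit.1 h
    change |(g • q).2 - s₀| = |q.2 - s₀|
    rw [deck_smul_snd, hs₀]
  let C : C(S2R, M) := ⟨c, hq.continuous⟩
  have hC : Topology.IsQuotientMap C := hq.toIsQuotientMap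
  let F := hC.lift f fun p q => hf p q
  obtain ⟨B, hB⟩ := (isCompact_range F.continuous).bddAbove
  have h1 : F (c (basePoint, s₀ + (|B| + 1))) = f (basePoint, s₀ + (|B| + 1)) :=
    congrArg (fun k => k (basePoint, s₀ + (|B| + 1))) (hC.lift_comp f fun p q => hf p q)
  have h2 : f (basePoint, s₀ + (|B| + 1)) = |B| + 1 := by
    change |s₀ + (|B| + 1) - s₀| = _
    rw [add_sub_cancel_left, abs_of_pos (by positivity)]
  have h3 := hB (mem_range_self (c (basePoint, s₀ + (|B| + 1))))
  rw [h1, h2] at h3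
  linarith [le_abs_self B]

theorem isCyclicByTwo_deckGroup [CompactSpace M] [T1Space M] (hc : IsCoveringMap c)
    (hq : IsQuotientCoveringMap c (deckGroup c)) : IsCyclicByTwo (deckGroup c) := by
  obtain ⟨a, ha⟩ := (shiftGroup c).dense_or_cyclic.resolve_left (not_dense_shiftGroup hc)
  have hmem : ∀ g : deckGroup c, deckSign g = 1 → ∃ n : ℤ, deckShift g = n * a := by
    intro g hg
    have h1 : deckShift g ∈ shiftGroup c := ⟨g, hg, rfl⟩
    rw [ha, AddSubgroup.mem_closure_singleton] at h1
    obtain ⟨n, hn⟩ := h1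
    exact ⟨n, by rw [← hn, zsmul_eq_mul]⟩
  obtain ⟨t, ht, hta⟩ : a ∈ shiftGroup c := by
    rw [ha]; exact AddSubgroup.subset_closure rfl
  have ha0 : a ≠ 0 := by
    rintro rfl
    obtain ⟨g, hg, hg0⟩ := exists_deckShift_ne_zero hq
    obtain ⟨n, hn⟩ := hmem g hg
    exact hg0 (by rw [hn, mul_zero])
  have htn : ∀ n : ℤ, t ^ n = 1 → n = 0 := by
    intro n hn
    have := deckShift_zpow ht n
    rw [hn, deckShift_one, hta] at this
    simpa [ha0] using this.symm
  have hker : ∀ g : deckGroup c, deckSign g = 1 → ∃ n : ℤ, deckSign (g * t ^ n) = 1 ∧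
      deckShift (g * t ^ n) = 0 := by
    intro g hg
    obtain ⟨n, hn⟩ := hmem g hg
    refine ⟨-n, ?_, ?_⟩
    · rw [deckSign_mul, hg, deckSign_zpow ht, one_mul]
    · rw [deckShift_mul, hg, deckShift_zpow ht, hta, hn]; push_cast; ring
  refine ⟨Subgroup.zpowers t, ?_⟩
  suffices h : ∃ s, ∀ g, g ∈ Subgroup.zpowers t ∨ s⁻¹ * g ∈ Subgroup.zpowers t by
    obtain ⟨s, hs⟩ := h
    exact ⟨(index_le_two_of_cosets s hs).1, (index_le_two_of_cosets s hs).2,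
      nonempty_zpowers_equiv htn⟩
  -- Case distinction on a nontrivial element `κ` that preserves every level. If it exists, it
  -- represents the second coset; otherwise a reflection does, if there is one.
  by_cases hκ : ∃ κ : deckGroup c, deckSign κ = 1 ∧ deckShift κ = 0 ∧ κ ≠ 1
  · obtain ⟨κ, hκ1, hκ0, hκne⟩ := hκ
    have hpos : ∀ g : deckGroup c, deckSign g = 1 := by
      intro g
      rcases (deck_spec g).sign with h | h
      · exact h
      · have hg1 : g ≠ 1 := by
          rintro rfl
          rw [deckSign_one] at h
          norm_num at h
        -- A reflection fixes the level at half its shift, where it would have to coincide with `κ`,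
        -- whose sign is `+`.
        have := deck_eq_of_fixed_level hc hg1 hκne (s := deckShift g / 2)
          (by rw [h]; ring) (by rw [hκ1, hκ0]; ring)
        rw [this, hκ1]
    refine ⟨κ, fun g => ?_⟩
    obtain ⟨n, h1, h0⟩ := hker g (hpos g)
    by_cases hg : g * t ^ n = 1
    · left
      rw [eq_inv_of_mul_eq_one_left hg]
      exact inv_mem (Subgroup.zpow_mem_zpowers t n)
    · right
      have := deck_eq_of_fixed_level hc hg hκne (s := 0) (by rw [h0]; ring) (by rw [hκ0]; ring)
      rw [← this]
      simp
  · push Not at hκ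
    have hmem' : ∀ g : deckGroup c, deckSign g = 1 → g ∈ Subgroup.zpowers t := by
      intro g hg
      obtain ⟨n, h1, h0⟩ := hker g hg
      rw [eq_inv_of_mul_eq_one_left (hκ _ h1 h0)]
      exact inv_mem (Subgroup.zpow_mem_zpowers t n)
    by_cases hr : ∃ r : deckGroup c, deckSign r = -1
    · obtain ⟨r, hr⟩ := hr
      refine ⟨r, fun g => ?_⟩
      rcases (deck_spec g).sign with h | h
      · exact Or.inl (hmem' g h)
      · exact Or.inr (hmem' _ (by rw [deckSign_mul, deckSign_inv, hr, h]; norm_num))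
    · exact ⟨1, fun g => Or.inl (hmem' g ((deck_spec g).sign.resolve_right fun h => hr ⟨g, h⟩))⟩

end deck

theorem IsCyclicByTwo.of_mulEquiv {G G' : Type*} [Group G] [Group G'] (e : G ≃* G')
    (h : IsCyclicByTwo G) : IsCyclicByTwo G' := by
  obtain ⟨H, h0, h2, ⟨f⟩⟩ := h
  have hi : (H.map e.toMonoidHom).index = H.index :=
    Subgroup.index_map_of_bijective (f := e.toMonoidHom) e.bijective H
  exact ⟨H.map e.toMonoidHom, by rwa [hi], by rwa [hi],
    ⟨(e.subgroupMap H).symm.trans f⟩⟩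

theorem isCyclicByTwo_of_isClosedS2RManifoldGroup {G : Type*} [Group G]
    (h : IsClosedS2RManifoldGroup G) : IsCyclicByTwo G := by
  obtain ⟨M, _, x, hM, ⟨c, hc, hs, ht⟩, ⟨e⟩⟩ := h
  have := hM.compact
  have := hM.hausdorff
  have hq := isQuotientCoveringMap_deckGroup hc hs ht
  obtain ⟨p, hp⟩ := hs x
  -- The fundamental group is the opposite of the deck group; inversion identifies a group with its
  -- opposite.
  exact (isCyclicByTwo_deckGroup hc hq).of_mulEquiv
    ((e.trans (hq.fundamentalGroupEquiv ⟨p, hp⟩)).trans (MulEquiv.inv' _).symm).symm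

/-! ### Groups with an infinite cyclic subgroup of index at most two -/

/-- The homomorphism from the group of order two given by an involution. -/
def involutionHom {G : Type*} [Group G] (s : G) (hs : s * s = 1) : CycTwo →* G where
  toFun e := if e = 1 then 1 else s
  map_one' := if_pos rfl
  map_mul' a b := by
    have h : ∀ a : CycTwo, a = 1 ∨ a = Multiplicative.ofAdd 1 := by decide
    have h1 : (Multiplicative.ofAdd 1 : CycTwo) ≠ 1 := by decide
    have h2 : (Multiplicative.ofAdd 1 : CycTwo) * Multiplicative.ofAdd 1 = 1 := by decide
    rcases h a with rfl | rfl <;> rcases h b with rfl | rfl <;> simp [h1, h2, hs]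

theorem involutionHom_ofAdd_one {G : Type*} [Group G] (s : G) (hs : s * s = 1) :
    involutionHom s hs (Multiplicative.ofAdd 1) = s :=
  if_neg (t := (1 : G)) (show ¬(Multiplicative.ofAdd 1 : CycTwo) = 1 by decide)

theorem cycTwo_cases (a : CycTwo) : a = 1 ∨ a = Multiplicative.ofAdd 1 := by
  revert a; decide

theorem cycTwo_hom_ext {G : Type*} [Group G] {f g : CycTwo →* G}
    (h : f (Multiplicative.ofAdd 1) = g (Multiplicative.ofAdd 1)) : f = g := by
  refine MonoidHom.ext fun a => ?_
  rcases cycTwo_cases a with rfl | rfl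
  · simp
  · exact h

theorem inversion_zpow {G : Type*} [Group G] {s t : G} (hst : s * t * s⁻¹ = t⁻¹) (n : ℤ) :
    t ^ n * s = s * t ^ (-n) := by
  have h : s * t ^ (-n) * s⁻¹ = t ^ n := by
    rw [← conj_zpow, hst, inv_zpow, ← zpow_neg, neg_neg]
  rw [← h]; group

/-- The exponent of a rotation in the infinite dihedral group. -/
def dihedralExp (i : ZMod 0) : ℤ := i

/-- The homomorphism from the infinite dihedral group given by an involution inverting an
element. -/
def dihedralHom {G : Type*} [Group G] (s t : G) (hs : s * s = 1) (hst : s * t * s⁻¹ = t⁻¹) :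
    DihedralGroup 0 →* G where
  toFun
    | .r i => t ^ dihedralExp i
    | .sr i => s * t ^ dihedralExp i
  map_one' := zpow_zero t
  map_mul' := by
    rintro (i | i) (j | j)
    · exact zpow_add t (dihedralExp i) (dihedralExp j)
    · change s * t ^ (dihedralExp j - dihedralExp i) = t ^ dihedralExp i * (s * t ^ dihedralExp j)
      rw [← mul_assoc, inversion_zpow hst, mul_assoc, ← zpow_add, neg_add_eq_sub]
    · change s * t ^ (dihedralExp i + dihedralExp j) = s * t ^ dihedralExp i * t ^ dihedralExp j
      rw [zpow_add, mul_assoc]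
    · change t ^ (dihedralExp j - dihedralExp i) = s * t ^ dihedralExp i * (s * t ^ dihedralExp j)
      rw [mul_assoc, ← mul_assoc (t ^ dihedralExp i), inversion_zpow hst, mul_assoc s, ← mul_assoc s, hs,
        one_mul, ← zpow_add, neg_add_eq_sub]

/-- The infinite dihedral group is the free product of two groups of order two. -/
theorem nonempty_dihedral_equiv_coprod :
    Nonempty (DihedralGroup 0 ≃* Monoid.Coprod CycTwo CycTwo) := by
  let a : Monoid.Coprod CycTwo CycTwo := Monoid.Coprod.inl (Multiplicative.ofAdd 1)
  let b : Monoid.Coprod CycTwo CycTwo := Monoid.Coprod.inr (Multiplicative.ofAdd 1)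
  have h2 : (Multiplicative.ofAdd 1 : CycTwo) * Multiplicative.ofAdd 1 = 1 := by decide
  have ha : a * a = 1 := by rw [← map_mul, h2, map_one]
  have hb : b * b = 1 := by rw [← map_mul, h2, map_one]
  have hai : a⁻¹ = a := inv_eq_of_mul_eq_one_right ha
  have hbi : b⁻¹ = b := inv_eq_of_mul_eq_one_right hb
  have hab : a * (a * b) * a⁻¹ = (a * b)⁻¹ := by
    rw [← mul_assoc, ha, one_mul, mul_inv_rev, hbi]
  -- The two free generators are the reflections `sr 0` and `sr 1`, and their product is the
  -- rotation `r 1`.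
  let D := dihedralHom a (a * b) ha hab
  let F : Monoid.Coprod CycTwo CycTwo →* DihedralGroup 0 :=
    Monoid.Coprod.lift (involutionHom _ (DihedralGroup.sr_mul_self 0))
      (involutionHom _ (DihedralGroup.sr_mul_self 1))
  have hFa : F a = .sr 0 := by
    simp only [F, a, Monoid.Coprod.lift_apply_inl, involutionHom_ofAdd_one]
  have hFb : F b = .sr 1 := by
    simp only [F, b, Monoid.Coprod.lift_apply_inr, involutionHom_ofAdd_one]
  have hFab : F (a * b) = .r 1 := by
    rw [map_mul, hFa, hFb, DihedralGroup.sr_mul_sr, sub_zero]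
  have h1 : F.comp D = MonoidHom.id _ := by
    ext x
    rcases x with i | i
    · change F ((a * b) ^ dihedralExp i) = .r i
      rw [map_zpow, hFab, DihedralGroup.r_one_zpow]
      rfl
    · change F (a * (a * b) ^ dihedralExp i) = .sr i
      rw [map_mul, map_zpow, hFab, DihedralGroup.r_one_zpow, hFa, DihedralGroup.sr_mul_r, zero_add]
      rfl
  have hD0 : D (.sr 0) = a := by
    change a * (a * b) ^ dihedralExp 0 = a
    rw [show dihedralExp 0 = 0 from rfl, zpow_zero, mul_one]
  have hD1 : D (.sr 1) = b := by
    change a * (a * b) ^ dihedralExp 1 = b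
    rw [show dihedralExp 1 = 1 from rfl, zpow_one, ← mul_assoc, ha, one_mul]
  have h3 : D.comp F = MonoidHom.id _ := by
    apply Monoid.Coprod.hom_ext
    · apply cycTwo_hom_ext
      change D (F a) = a
      rw [hFa, hD0]
    · apply cycTwo_hom_ext
      change D (F b) = b
      rw [hFb, hD1]
  exact ⟨MonoidHom.toMulEquiv D F h1 h3⟩

theorem nonempty_equiv_cycInf {G : Type*} [Group G] {t : G} (ht : ∀ n : ℤ, t ^ n = 1 → n = 0)
    (hG : ∀ g, g ∈ Subgroup.zpowers t) : Nonempty (G ≃* CycInf) := by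
  obtain ⟨e⟩ := nonempty_zpowers_equiv ht
  rw [(Subgroup.eq_top_iff' _).2 hG] at e
  exact ⟨Subgroup.topEquiv.symm.trans e⟩

theorem IsCyclicByTwo.exists_generator {G : Type*} [Group G] (h : IsCyclicByTwo G) :
    ∃ t : G, (∀ n : ℤ, t ^ n = 1 → n = 0) ∧ (Subgroup.zpowers t).index ≠ 0 ∧
      (Subgroup.zpowers t).index ≤ 2 := by
  obtain ⟨H, h0, h2, ⟨e⟩⟩ := h
  let t : H := e.symm (Multiplicative.ofAdd 1)
  have hH : Subgroup.zpowers (t : G) = H := by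
    ext g
    constructor
    · rintro ⟨n, rfl⟩
      exact zpow_mem t.2 n
    · intro hg
      refine ⟨Multiplicative.toAdd (e ⟨g, hg⟩), ?_⟩
      have : t ^ (Multiplicative.toAdd (e ⟨g, hg⟩)) = ⟨g, hg⟩ := by
        apply e.injective
        rw [map_zpow, e.apply_symm_apply, ← ofAdd_zsmul, smul_eq_mul, mul_one, ofAdd_toAdd]
      exact congrArg Subtype.val this
  refine ⟨t, fun n hn => ?_, by rwa [hH], by rwa [hH]⟩
  have h1 : t ^ n = 1 := Subtype.ext hn
  have h3 := congrArg e h1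
  rw [map_zpow, e.apply_symm_apply, ← ofAdd_zsmul, smul_eq_mul, mul_one, map_one] at h3
  exact h3

/-- An extension of the infinite cyclic group by a group of order at most two is infinite cyclic, or
its direct product with a group of order two, or infinite dihedral. -/
theorem IsCyclicByTwo.classification {G : Type*} [Group G] (h : IsCyclicByTwo G) :
    Nonempty (G ≃* CycInf) ∨ Nonempty (G ≃* CycInf × CycTwo) ∨
      Nonempty (G ≃* DihedralGroup 0) := by
  obtain ⟨t, ht, h0, h2⟩ := h.exists_generator
  have hinj : ∀ {m n : ℤ}, t ^ m = t ^ n → m = n := fun {m n} hmn => by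
    have := ht (m - n) (by rw [zpow_sub, hmn, mul_inv_cancel])
    linarith
  by_cases h1 : (Subgroup.zpowers t).index = 1
  · rw [Subgroup.index_eq_one] at h1
    exact Or.inl (nonempty_equiv_cycInf ht fun g => by rw [h1]; trivial)
  have hi : (Subgroup.zpowers t).index = 2 := by omega
  have hN := Subgroup.normal_of_index_eq_two hi
  obtain ⟨s, hs⟩ := exists_coset_rep_of_index_le_two h0 h2
  have hsH : s ∉ Subgroup.zpowers t := by
    intro hs'
    apply h1
    rw [Subgroup.index_eq_one, Subgroup.eq_top_iff']
    intro g
    refine (hs g).elim id fun h => ?_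
    simpa using mul_mem hs' h
  have hcov : ∀ g, (∃ n : ℤ, g = t ^ n) ∨ ∃ n : ℤ, g = s * t ^ n := by
    intro g
    rcases hs g with ⟨n, hn⟩ | ⟨n, hn⟩
    · exact Or.inl ⟨n, hn.symm⟩
    · exact Or.inr ⟨n, by simp only at hn; rw [hn]; group⟩
  obtain ⟨m, hm⟩ : ∃ m : ℤ, s * s = t ^ m := by
    rcases hcov (s * s) with h | ⟨n, hn⟩
    · exact h
    · exact absurd ⟨n, (mul_left_cancel hn).symm⟩ hsH
  obtain ⟨k, hk⟩ := hN.conj_mem t (Subgroup.mem_zpowers t) s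
  obtain ⟨l, hl⟩ := hN.conj_mem t (Subgroup.mem_zpowers t) s⁻¹
  simp only [inv_inv] at hk hl
  -- Conjugation by `s` and by `s⁻¹` raises `t` to the powers `k` and `l`; these automorphisms are
  -- mutually inverse, so `k = ±1`.
  have hkl : k * l = 1 := by
    apply hinj
    rw [zpow_mul, hk, conj_zpow, hl]
    group
  rcases Int.eq_one_or_neg_one_of_mul_eq_one hkl with rfl | rfl
  · rw [zpow_one] at hk
    have hcomm : Commute s t := eq_mul_inv_iff_mul_eq.1 hk |>.symm
    -- Changing the coset representative alters the exponent of its square by an even number. For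
    -- even `m` it becomes zero and the group splits; for odd `m` it becomes one and the
    -- representative generates the whole group.
    have hsj : ∀ j : ℤ, (s * t ^ j) * (s * t ^ j) = t ^ (m + 2 * j) := by
      intro j
      rw [mul_assoc, ← mul_assoc (t ^ j), ← (hcomm.zpow_right j).eq, mul_assoc s, ← mul_assoc s, hm,
        ← zpow_add, ← zpow_add]
      congr 1; ring
    rcases Int.even_or_odd' m with ⟨j, hj | hj⟩
    · right; left
      have hs2 : (s * t ^ (-j)) * (s * t ^ (-j)) = 1 := by
        rw [hsj, hj]; simp
      have hc : ∀ (n : CycInf) (e : CycTwo),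
          Commute (zpowersHom G t n) (involutionHom _ hs2 e) := by
        intro n e
        rcases cycTwo_cases e with rfl | rfl
        · rw [map_one]; exact Commute.one_right _
        · rw [involutionHom_ofAdd_one, zpowersHom_apply]
          exact ((hcomm.symm.zpow_left _).mul_right ((Commute.refl t).zpow_zpow _ _))
      refine ⟨(MulEquiv.ofBijective (MonoidHom.noncommCoprod _ _ hc) ⟨?_, ?_⟩).symm⟩
      · rw [injective_iff_map_eq_one]
        rintro ⟨n, e⟩ hne
        rw [MonoidHom.noncommCoprod_apply, zpowersHom_apply] at hne
        rcases cycTwo_cases e with rfl | rfl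
        · rw [map_one, mul_one] at hne
          exact Prod.ext (ht _ hne) rfl
        · rw [involutionHom_ofAdd_one] at hne
          refine absurd ⟨-Multiplicative.toAdd n + j, ?_⟩ hsH
          simp only [zpow_add, zpow_neg]
          rw [← eq_inv_of_mul_eq_one_right hne]
          simp
      · intro g
        rcases hcov g with ⟨n, rfl⟩ | ⟨n, rfl⟩
        · refine ⟨(Multiplicative.ofAdd n, 1), ?_⟩
          rw [MonoidHom.noncommCoprod_apply, zpowersHom_apply, map_one, mul_one]
          rfl
        · refine ⟨(Multiplicative.ofAdd (n + j), Multiplicative.ofAdd 1), ?_⟩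
          rw [MonoidHom.noncommCoprod_apply, zpowersHom_apply, involutionHom_ofAdd_one,
            toAdd_ofAdd, ← mul_assoc, ← (hcomm.zpow_right _).eq, mul_assoc, ← zpow_add]
          congr 2; ring
    · left
      have hs2 : (s * t ^ (-j)) * (s * t ^ (-j)) = t := by
        rw [hsj, hj]; simp
      have hs2' : t = (s * t ^ (-j)) ^ (2 : ℤ) := by rw [zpow_two, hs2]
      apply nonempty_equiv_cycInf (t := s * t ^ (-j))
      · intro n hn
        apply ht
        rw [hs2', ← zpow_mul, mul_comm, zpow_mul, hn, one_zpow]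
      · have htmem : t ∈ Subgroup.zpowers (s * t ^ (-j)) := ⟨2, hs2'.symm⟩
        have hsmem : s ∈ Subgroup.zpowers (s * t ^ (-j)) := by
          have := mul_mem (Subgroup.mem_zpowers (s * t ^ (-j))) (zpow_mem htmem j)
          simpa using this
        intro g
        rcases hcov g with ⟨n, rfl⟩ | ⟨n, rfl⟩
        · exact zpow_mem htmem n
        · exact mul_mem hsmem (zpow_mem htmem n)
  · right; right
    rw [zpow_neg_one] at hk
    -- The element `t ^ m = s * s` commutes with `s`, yet `s` inverts it.
    have hm0 : m = 0 := by
      have h3 := inversion_zpow hk.symm m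
      rw [← hm, mul_assoc] at h3
      have h4 := mul_left_cancel h3
      rw [hm] at h4
      have := hinj h4
      omega
    rw [hm0, zpow_zero] at hm
    refine ⟨(MulEquiv.ofBijective (dihedralHom s t hm hk.symm) ⟨?_, ?_⟩).symm⟩
    · rw [injective_iff_map_eq_one]
      rintro (i | i) hi
      · exact congrArg DihedralGroup.r (ht (dihedralExp i) hi)
      · refine absurd ⟨-dihedralExp i, ?_⟩ hsH
        beta_reduce
        rw [zpow_neg]
        exact (eq_inv_of_mul_eq_one_left hi).symm
    · intro g
      rcases hcov g with ⟨n, rfl⟩ | ⟨n, rfl⟩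
      · exact ⟨.r n, rfl⟩
      · exact ⟨.sr n, rfl⟩

/-! ### Quotients of `S² × ℝ` -/

/-- Data of an action of `G` on `S² × ℝ` by `(x, s) ↦ (σ x, ε s + b)` that is free and contains
a unit translation. -/
structure SignedAction (G : Type) [Group G] where
  σ : G →* ℤˣ
  ε : G →* ℤˣ
  b : G → ℤ
  b_mul : ∀ g h, b (g * h) = b g + ε g * b h
  free : ∀ g, σ g = 1 → ε g = -1 ∨ b g = 0 → g = 1
  t : G
  ε_t : ε t = 1
  b_t : b t = 1

/-- A unit acting on the sphere. -/
noncomputable def signSphere (u : ℤˣ) (x : S2) : S2 :=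
  ⟨((u : ℤ) : ℝ) • (x : E3), by
    rw [mem_sphere_zero_iff_norm, norm_smul, norm_S2]
    rcases Int.units_eq_one_or u with rfl | rfl <;> simp⟩

theorem signSphere_one (x : S2) : signSphere 1 x = x := Subtype.ext (by simp [signSphere])

theorem signSphere_mul (u v : ℤˣ) (x : S2) :
    signSphere (u * v) x = signSphere u (signSphere v x) :=
  Subtype.ext (by simp [signSphere, mul_smul])

theorem continuous_signSphere (u : ℤˣ) : Continuous (signSphere u) :=
  Continuous.subtype_mk (by fun_prop) _

theorem S2_ne_neg (x : S2) : (x : E3) ≠ -x := by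
  intro h
  have h1 : (2 : ℝ) • (x : E3) = 0 := by
    rw [two_smul]
    nth_rewrite 1 [h]
    exact neg_add_cancel _
  have h2 := (smul_eq_zero.1 h1).resolve_left two_ne_zero
  have h3 := norm_S2 x
  rw [h2, norm_zero] at h3
  exact zero_ne_one h3

theorem signSphere_eq_self {u : ℤˣ} {x : S2} (h : signSphere u x = x) : u = 1 := by
  rcases Int.units_eq_one_or u with rfl | rfl
  · rfl
  · have h1 : -(x : E3) = x := by simpa [signSphere] using congrArg Subtype.val h
    exact absurd h1.symm (S2_ne_neg x)

theorem ang_signSphere (u : ℤˣ) (x y : S2) : ang (signSphere u x) (signSphere u y) = ang x y := by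
  rcases Int.units_eq_one_or u with rfl | rfl
  · rw [signSphere_one, signSphere_one]
  · simp [ang, signSphere, InnerProductGeometry.angle_neg_neg]

namespace SignedAction

variable {G : Type} [Group G] (A : SignedAction G)

theorem b_one : A.b 1 = 0 := by
  have := A.b_mul 1 1
  rw [mul_one, map_one] at this
  simpa using this

/-- The action on `S² × ℝ`. -/
@[reducible] noncomputable def action : MulAction G S2R where
  smul g p := (signSphere (A.σ g) p.1, ((A.ε g : ℤ) : ℝ) * p.2 + A.b g)
  one_smul p := by
    refine Prod.ext ?_ ?_
    · change signSphere (A.σ 1) p.1 = p.1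
      rw [map_one, signSphere_one]
    · change ((A.ε 1 : ℤ) : ℝ) * p.2 + A.b 1 = p.2
      rw [map_one, A.b_one]; simp
  mul_smul g h p := by
    refine Prod.ext ?_ ?_
    · change signSphere (A.σ (g * h)) p.1 = signSphere (A.σ g) (signSphere (A.σ h) p.1)
      rw [map_mul, signSphere_mul]
    · change ((A.ε (g * h) : ℤ) : ℝ) * p.2 + A.b (g * h) =
        ((A.ε g : ℤ) : ℝ) * (((A.ε h : ℤ) : ℝ) * p.2 + A.b h) + A.b g
      rw [map_mul, A.b_mul]; push_cast; ring

/-- Equal shifts make the shift of `g⁻¹ * h` vanish, and freeness then applies. Thus `σ` and `b`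
alone determine an element, which reduces proper discontinuity to a bound on `b`. -/
theorem ext_data {g h : G} (h1 : A.σ g = A.σ h) (h3 : A.b g = A.b h) :
    g = h := by
  rw [← inv_mul_eq_one]
  apply A.free
  · rw [map_mul, map_inv, h1, inv_mul_cancel]
  · right
    have := A.b_mul g (g⁻¹ * h)
    rw [mul_inv_cancel_left, h3] at this
    have h4 : (A.ε g : ℤ) * A.b (g⁻¹ * h) = 0 := by linarith
    exact (mul_eq_zero.1 h4).resolve_left (Units.ne_zero _)

/-- The quotient of `S² × ℝ` by the action. -/
abbrev Quot : Type := letI := A.action; Quotient (MulAction.orbitRel G S2R)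

/-- The projection to the quotient. -/
noncomputable def proj : S2R → A.Quot := letI := A.action; Quotient.mk (MulAction.orbitRel G S2R)

theorem continuousConstSMul : letI := A.action; ContinuousConstSMul G S2R := by
  let := A.action
  refine ⟨fun g => ?_⟩
  exact Continuous.prodMk ((continuous_signSphere _).comp continuous_fst) (by fun_prop)

/-- A fixed point forces `σ g = 1`, since the antipodal map has none, and a fixed height requires `ε
g = -1` or `b g = 0`; this is exactly what `free` excludes for `g ≠ 1`. -/
theorem isCancelSMul : letI := A.action; IsCancelSMul G S2R := by
  let := A.action
  rw [isCancelSMul_iff_eq_one_of_smul_eq]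
  intro g p h
  have h1 : signSphere (A.σ g) p.1 = p.1 := congrArg Prod.fst h
  have h2 : ((A.ε g : ℤ) : ℝ) * p.2 + A.b g = p.2 := congrArg Prod.snd h
  apply A.free g (signSphere_eq_self h1)
  rcases Int.units_eq_one_or (A.ε g) with h3 | h3
  · right
    rw [h3] at h2
    simpa using h2
  · exact Or.inl h3

theorem properlyDiscontinuousSMul : letI := A.action; ProperlyDiscontinuousSMul G S2R := by
  let := A.action
  refine ⟨fun {K L} hK hL => ?_⟩
  obtain ⟨a, ha⟩ := (hK.image (continuous_snd.abs : Continuous fun p : S2R => |p.2|)).bddAbove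
  obtain ⟨b, hb⟩ := (hL.image (continuous_snd.abs : Continuous fun p : S2R => |p.2|)).bddAbove
  have hinj : Function.Injective fun g => (A.σ g, A.b g) := by
    intro g h hgh
    simp only [Prod.mk.injEq] at hgh
    exact A.ext_data hgh.1 hgh.2
  refine Set.Finite.subset (Set.Finite.preimage hinj.injOn
    ((finite_univ (α := ℤˣ)).prod
      (finite_Icc (-⌈a + b⌉) ⌈a + b⌉))) ?_
  rintro g ⟨_, ⟨p, hp, rfl⟩, hgp⟩
  refine ⟨mem_univ _, ?_⟩
  have h1 : |p.2| ≤ a := ha ⟨p, hp, rfl⟩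
  have h2 : |((A.ε g : ℤ) : ℝ) * p.2 + A.b g| ≤ b := hb ⟨_, hgp, rfl⟩
  -- The shift is the difference between the new height and plus or minus the old one, both bounded
  -- on the compact sets.
  have h3 : |(A.b g : ℝ)| ≤ a + b := by
    have h4 : |((A.ε g : ℤ) : ℝ) * p.2| = |p.2| := by
      rcases Int.units_eq_one_or (A.ε g) with h | h <;> rw [h] <;> simp
    calc |(A.b g : ℝ)| = |(((A.ε g : ℤ) : ℝ) * p.2 + A.b g) - ((A.ε g : ℤ) : ℝ) * p.2| := by
          congr 1; ring
      _ ≤ _ := abs_sub _ _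
      _ ≤ a + b := by rw [h4]; linarith
  have h5 : |(A.b g : ℝ)| ≤ ⌈a + b⌉ := h3.trans (Int.le_ceil _)
  rw [mem_Icc, ← abs_le]
  exact_mod_cast h5

theorem isQuotientCoveringMap : letI := A.action; IsQuotientCoveringMap A.proj G := by
  let := A.action
  have := A.continuousConstSMul
  have := A.isCancelSMul
  have := A.properlyDiscontinuousSMul
  exact isQuotientCoveringMap_quotientMk_of_properlyDiscontinuousSMul

theorem isModelledOnS2R : IsModelledOnS2R A.Quot := by
  let := A.action
  have := A.continuousConstSMul
  have hq := A.isQuotientCoveringMap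
  refine ⟨A.proj, hq.isCoveringMap, hq.surjective, fun p q hpq => ?_⟩
  obtain ⟨g, rfl⟩ := hq.apply_eq_iff_mem_orbit.1 hpq.symm
  refine ⟨Homeomorph.smul g, fun x y => ?_, fun x => hq.map_smul g, rfl⟩
  change Real.sqrt (ang (signSphere (A.σ g) x.1) (signSphere (A.σ g) y.1) ^ 2 +
    ((((A.ε g : ℤ) : ℝ) * x.2 + A.b g) - (((A.ε g : ℤ) : ℝ) * y.2 + A.b g)) ^ 2) = _
  rw [ang_signSphere, s2rDist]
  congr 2
  rcases Int.units_eq_one_or (A.ε g) with h | h <;> rw [h] <;> push_cast <;> ring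

/-- Powers of `t` bring every height into the unit interval, so the quotient is the image of a
compact slab. -/
theorem compactSpace : CompactSpace A.Quot := by
  let := A.action
  have hq := A.isQuotientCoveringMap
  have hc : IsCompact (A.proj '' (univ ×ˢ Icc (0 : ℝ) 1)) :=
    (isCompact_univ.prod isCompact_Icc).image hq.continuous
  refine ⟨?_⟩
  convert hc
  symm
  rw [eq_univ_iff_forall]
  intro m
  obtain ⟨p, rfl⟩ := hq.surjective m
  have hε : ∀ n : ℤ, A.ε (A.t ^ n) = 1 := fun n => by rw [map_zpow, A.ε_t, one_zpow]
  have hb : ∀ n : ℤ, A.b (A.t ^ n) = n := by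
    have hadd : ∀ n : ℤ, A.b (A.t ^ (n + 1)) = A.b (A.t ^ n) + 1 := fun n => by
      rw [zpow_add_one, A.b_mul, hε, A.b_t]; simp
    intro n
    induction n using Int.induction_on with
    | zero => rw [zpow_zero, A.b_one]
    | succ n ih => rw [hadd, ih]
    | pred n ih =>
      have := hadd (-(n : ℤ) - 1)
      rw [sub_add_cancel, ih] at this
      linarith
  refine ⟨A.t ^ (-⌊p.2⌋) • p, ⟨mem_univ _, ?_⟩, hq.map_smul _⟩
  change ((A.ε (A.t ^ (-⌊p.2⌋)) : ℤ) : ℝ) * p.2 + A.b (A.t ^ (-⌊p.2⌋)) ∈ Icc (0 : ℝ) 1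
  rw [hε, hb]
  have h1 := Int.floor_le p.2
  have h2 := Int.lt_floor_add_one p.2
  constructor <;> push_cast <;> linarith

/-- A chart of `S² × ℝ` whose domain contains the given point. -/
noncomputable def chartS2R (p : S2R) : OpenPartialHomeomorph S2R E3 :=
  haveI : Fact (Module.finrank ℝ E3 = 2 + 1) := ⟨by simp⟩
  ((stereographic' 2 (-p.1)).prod (OpenPartialHomeomorph.refl ℝ)).trans
    (ContinuousLinearEquiv.ofFinrankEq (𝕜 := ℝ) (E := EuclideanSpace ℝ (Fin 2) × ℝ) (F := E3)
      (by simp)).toHomeomorph.toOpenPartialHomeomorph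

theorem mem_chartS2R_source (p : S2R) : p ∈ (chartS2R p).source := by
  have h : p.1 ≠ -p.1 := fun h => S2_ne_neg p.1 (congrArg Subtype.val h)
  simp [chartS2R, h]

/-- Charts are local inverses of the projection followed by charts of `S² × ℝ`, each centred at a
chosen preimage. -/
theorem locallyEuclidean : Nonempty (ChartedSpace E3 A.Quot) := by
  let := A.action
  have hq := A.isQuotientCoveringMap
  have hl := hq.isCoveringMap.isLocalHomeomorph
  choose s hs using hq.surjective
  choose e he hep using fun m => hl (s m)
  have hmem : ∀ m, m ∈ (e m).target := fun m => by
    have := (e m).map_source (he m)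
    rwa [← hep, hs] at this
  have hsymm : ∀ m, (e m).symm m = s m := fun m => by
    have := (e m).left_inv (he m)
    rwa [← hep, hs] at this
  exact ⟨{
    atlas := range fun m => (e m).symm.trans (chartS2R (s m))
    chartAt := fun m => (e m).symm.trans (chartS2R (s m))
    mem_chart_source := fun m => by
      rw [OpenPartialHomeomorph.trans_source]
      refine ⟨hmem m, ?_⟩
      rw [mem_preimage, hsymm]
      exact mem_chartS2R_source _
    chart_mem_atlas := fun m => mem_range_self m }⟩

theorem isClosedThreeManifold : IsClosedThreeManifold A.Quot := by
  let := A.action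
  have := A.continuousConstSMul
  have := A.properlyDiscontinuousSMul
  have hq := A.isQuotientCoveringMap
  exact
    { compact := A.compactSpace
      connected := hq.surjective.connectedSpace hq.continuous
      hausdorff := t2Space_of_properlyDiscontinuousSMul_of_t2Space
      locallyEuclidean := A.locallyEuclidean }

theorem isClosedS2RManifoldGroup (A : SignedAction G) {G' : Type*} [Group G'] (e : G' ≃* G) :
    IsClosedS2RManifoldGroup G' := by
  let := A.action
  have hq := A.isQuotientCoveringMap
  let p : S2R := (basePoint, 0)
  exact ⟨A.Quot, inferInstance, A.proj p, A.isClosedThreeManifold, A.isModelledOnS2R,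
    ⟨(e.trans (MulEquiv.inv' G)).trans (hq.fundamentalGroupEquiv ⟨p, rfl⟩).symm⟩⟩

end SignedAction

/-- The action of the infinite cyclic group by translations. -/
def cycInfAction : SignedAction CycInf where
  σ := 1
  ε := 1
  b := Multiplicative.toAdd
  b_mul g h := by simp
  free g _ h := by
    rcases h with h | h
    · exact absurd (show (1 : ℤˣ) = -1 from h) (by decide)
    · exact Multiplicative.toAdd.injective h
  t := Multiplicative.ofAdd 1
  ε_t := rfl
  b_t := rfl

/-- The action of `ℤ × ℤ/2` by translations and the antipodal map. -/
def cycInfProdCycTwoAction : SignedAction (CycInf × CycTwo) where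
  σ := (involutionHom (-1 : ℤˣ) (by decide)).comp (MonoidHom.snd _ _)
  ε := 1
  b g := Multiplicative.toAdd g.1
  b_mul g h := by simp
  free g hσ h := by
    rcases h with h | h
    · exact absurd (show (1 : ℤˣ) = -1 from h) (by decide)
    · refine Prod.ext (Multiplicative.toAdd.injective h) ?_
      rcases cycTwo_cases g.2 with h2 | h2
      · exact h2
      · rw [MonoidHom.comp_apply, MonoidHom.coe_snd, h2, involutionHom_ofAdd_one] at hσ
        exact absurd hσ (by decide)
  t := (Multiplicative.ofAdd 1, 1)
  ε_t := rfl
  b_t := rfl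

/-- The sign of an element of the infinite dihedral group. -/
def dihedralSign : DihedralGroup 0 →* ℤˣ where
  toFun
    | .r _ => 1
    | .sr _ => -1
  map_one' := rfl
  map_mul' := by rintro (i | i) (j | j) <;> rfl

/-- The action of the infinite dihedral group by translations and antipodal reflections. -/
def dihedralAction : SignedAction (DihedralGroup 0) where
  σ := dihedralSign
  ε := dihedralSign
  b
    | .r i => dihedralExp i
    | .sr i => -dihedralExp i
  b_mul := by
    rintro (i | i) (j | j)
    · change dihedralExp i + dihedralExp j = dihedralExp i + 1 * dihedralExp j
      ring
    · change -(dihedralExp j - dihedralExp i) = dihedralExp i + 1 * -dihedralExp j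
      ring
    · change -(dihedralExp i + dihedralExp j) = -dihedralExp i + -1 * dihedralExp j
      ring
    · change dihedralExp j - dihedralExp i = -dihedralExp i + -1 * -dihedralExp j
      ring
  free := by
    rintro (i | i) hσ h
    · rcases h with h | h
      · exact absurd (show (1 : ℤˣ) = -1 from h) (by decide)
      · exact congrArg DihedralGroup.r h
    · exact absurd (show (-1 : ℤˣ) = 1 from hσ) (by decide)
  t := .r 1
  ε_t := rfl
  b_t := rfl

/-! ### Characterisations of the manifold groups -/

theorem isClosedS2RManifoldGroup_iff_equiv (G : Type*) [Group G] : IsClosedS2RManifoldGroup G ↔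
    (Nonempty (G ≃* CycInf) ∨ Nonempty (G ≃* CycInf × CycTwo) ∨
      Nonempty (G ≃* Monoid.Coprod CycTwo CycTwo)) := by
  obtain ⟨d⟩ := nonempty_dihedral_equiv_coprod
  constructor
  · intro h
    exact (isCyclicByTwo_of_isClosedS2RManifoldGroup h).classification.imp id
      (Or.imp id fun ⟨e⟩ => ⟨e.trans d⟩)
  · rintro (⟨⟨e⟩⟩ | ⟨⟨e⟩⟩ | ⟨⟨e⟩⟩)
    · exact cycInfAction.isClosedS2RManifoldGroup e
    · exact cycInfProdCycTwoAction.isClosedS2RManifoldGroup e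
    · exact dihedralAction.isClosedS2RManifoldGroup (e.trans d.symm)

theorem isClosedS2RManifoldGroup_iff_isCyclicByTwo (G : Type*) [Group G] :
    IsClosedS2RManifoldGroup G ↔ IsCyclicByTwo G := by
  refine ⟨isCyclicByTwo_of_isClosedS2RManifoldGroup, fun h => ?_⟩
  rcases h.classification with ⟨⟨e⟩⟩ | ⟨⟨e⟩⟩ | ⟨⟨e⟩⟩
  · exact cycInfAction.isClosedS2RManifoldGroup e
  · exact cycInfProdCycTwoAction.isClosedS2RManifoldGroup e
  · exact dihedralAction.isClosedS2RManifoldGroup e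

/-! ### Predicates that are decidable on a set of presentations -/

/-- One algorithm decides the predicate `p` for all presentations in `D`. -/
def DecOn (D : Set Presentation) {α : Type} [Primcodable α] (p : Presentation → α → Prop) : Prop :=
  ∃ h : Presentation × α →. Bool, Partrec h ∧
    ∀ P ∈ D, ∀ a, ∃ b ∈ h (P, a), (b = true ↔ p P a)

section DecOn

variable {D : Set Presentation} {α β : Type} [Primcodable α] [Primcodable β]

theorem DecOn.of_iff {p q : Presentation → α → Prop} (hp : DecOn D p)
    (h : ∀ P a, p P a ↔ q P a) : DecOn D q := by
  obtain rfl : p = q := funext fun P => funext fun a => propext (h P a)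
  exact hp

theorem DecOn.of_primrecPred {p : Presentation → α → Prop}
    (hp : PrimrecPred fun x : Presentation × α => p x.1 x.2) : DecOn D p := by
  classical
  exact ⟨_, hp.decide.to_comp.partrec, fun P _ a => ⟨decide (p P a), by simp, by simp⟩⟩

theorem DecOn.comp {p : Presentation → β → Prop} (hp : DecOn D p) {g : Presentation × α → β}
    (hg : Computable g) : DecOn D fun P a => p P (g (P, a)) := by
  obtain ⟨h, hh, H⟩ := hp
  exact ⟨_, hh.comp (Computable.fst.pair hg), fun P hP a => H P hP _⟩

theorem DecOn.not {p : Presentation → α → Prop} (hp : DecOn D p) : DecOn D fun P a => ¬p P a := by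
  obtain ⟨h, hh, H⟩ := hp
  refine ⟨_, hh.map (Primrec.not.to_comp.comp Computable.snd).to₂, fun P hP a => ?_⟩
  obtain ⟨b, hb, hb'⟩ := H P hP a
  refine ⟨!b, Part.mem_map _ hb, ?_⟩
  change _ ↔ ¬p P a
  rw [← hb']
  cases b <;> simp

theorem DecOn.and {p q : Presentation → α → Prop} (hp : DecOn D p) (hq : DecOn D q) :
    DecOn D fun P a => p P a ∧ q P a := by
  obtain ⟨h, hh, H⟩ := hp
  obtain ⟨k, hk, K⟩ := hq
  refine ⟨fun x => (h x).bind fun b => (k x).map fun c => b && c,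
    hh.bind ((hk.comp Computable.fst).map
      (Primrec.and.to_comp.comp (Computable.snd.comp Computable.fst) Computable.snd).to₂).to₂,
    fun P hP a => ?_⟩
  obtain ⟨b, hb, hb'⟩ := H P hP a
  obtain ⟨c, hc, hc'⟩ := K P hP a
  refine ⟨b && c, Part.mem_bind hb (Part.mem_map _ hc), ?_⟩
  change _ ↔ p P a ∧ q P a
  rw [← hb', ← hc', Bool.and_eq_true]

theorem DecOn.or {p q : Presentation → α → Prop} (hp : DecOn D p) (hq : DecOn D q) :
    DecOn D fun P a => p P a ∨ q P a :=
  (hp.not.and hq.not).not.of_iff fun P a => by tauto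

/-- Bounded universal quantification over a computable list. -/
theorem DecOn.forall_mem [Inhabited β] {p : Presentation → α × β → Prop} (hp : DecOn D p)
    {l : Presentation × α → List β} (hl : Computable l) :
    DecOn D fun P a => ∀ b ∈ l (P, a), p P (a, b) := by
  obtain ⟨h, hh, H⟩ := hp
  -- Recursion on the number of list entries tested. The default entry is never reached, as only
  -- indices below the length are used.
  let r : Presentation × α → ℕ →. Bool := fun x n =>
    n.rec (Part.some true) fun k ih => ih.bind fun c =>
      (h (x.1, (x.2, (l x).getD k default))).map fun b => c && b
  have hr : Partrec fun x => r x (l x).length := by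
    refine Partrec.nat_rec (Computable.list_length.comp hl) (Computable.const true).partrec
      (h := fun x y => (h (x.1, (x.2, (l x).getD y.1 default))).map fun b => y.2 && b) ?_
    have hg : Computable fun z : (Presentation × α) × (ℕ × Bool) =>
        (z.1.1, (z.1.2, (l z.1).getD z.2.1 default)) :=
      (Computable.fst.comp Computable.fst).pair ((Computable.snd.comp Computable.fst).pair
        ((Primrec.list_getD (default : β)).to_comp.comp (hl.comp Computable.fst)
          (Computable.fst.comp Computable.snd)))
    have hm : Computable₂ fun (z : (Presentation × α) × (ℕ × Bool)) (b : Bool) => z.2.2 && b :=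
      Primrec.and.to_comp.comp₂
        (Computable.snd.comp (Computable.snd.comp Computable.fst)).to₂ Computable.snd.to₂
    exact (Partrec.map (hh.comp hg) hm).to₂
  refine ⟨_, hr, fun P hP a => ?_⟩
  have key : ∀ n, ∃ b ∈ r (P, a) n, (b = true ↔ ∀ k < n, p P (a, (l (P, a)).getD k default)) := by
    intro n
    induction n with
    | zero => exact ⟨true, Part.mem_some _, by simp⟩
    | succ n ih =>
      obtain ⟨c, hc, hc'⟩ := ih
      obtain ⟨b, hb, hb'⟩ := H P hP (a, (l (P, a)).getD n default)
      refine ⟨c && b, Part.mem_bind hc (Part.mem_map _ hb), ?_⟩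
      rw [Bool.and_eq_true, hc', hb', Nat.forall_lt_succ_right]
  obtain ⟨b, hb, hb'⟩ := key (l (P, a)).length
  refine ⟨b, hb, hb'.trans ⟨fun h x hx => ?_, fun h k hk => h _ ?_⟩⟩
  · obtain ⟨k, hk, rfl⟩ := List.mem_iff_getElem.1 hx
    have := h k hk
    rwa [List.getD_eq_getElem _ _ hk] at this
  · rw [List.getD_eq_getElem _ _ hk]
    exact List.getElem_mem hk

theorem DecOn.exists_mem [Inhabited β] {p : Presentation → α × β → Prop} (hp : DecOn D p)
    {l : Presentation × α → List β} (hl : Computable l) :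
    DecOn D fun P a => ∃ b ∈ l (P, a), p P (a, b) :=
  (hp.not.forall_mem hl).not.of_iff fun P a => by push Not; rfl

theorem primrecRel_mem {γ : Type} [Primcodable γ] : PrimrecRel fun (a : γ) (l : List γ) => a ∈ l :=
  ((PrimrecRel.exists_mem_list Primrec.eq).swap).of_eq fun a l => by simp [Function.swap]

theorem primrecPred_mem_allPresentations : PrimrecPred fun P : Presentation => P ∈ allPresentations := by
  have h1 : PrimrecRel fun (a : ℕ × Bool) (l : List ℕ) => a.1 ∈ l :=
    primrecRel_mem.comp (Primrec.fst.comp Primrec.fst) Primrec.snd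
  have h2 : PrimrecRel fun (r : Word) (l : List ℕ) => ∀ a ∈ r, a.1 ∈ l :=
    PrimrecRel.forall_mem_list h1
  have h3 : PrimrecRel fun (R : List Word) (l : List ℕ) => ∀ r ∈ R, ∀ a ∈ r, a.1 ∈ l :=
    PrimrecRel.forall_mem_list h2
  exact h3.comp Primrec.snd Primrec.fst

/-- The projection of a predicate that is decidable on `D` is recursively enumerable on `D`. -/
theorem DecOn.exists_recEnum {p : Presentation → ℕ → Prop} (hp : DecOn D p)
    (hD : D ⊆ allPresentations) :
    ∃ X, RecEnum X ∧ ∀ P ∈ D, (P ∈ X ↔ ∃ n, p P n) := by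
  obtain ⟨h, hh, H⟩ := hp
  obtain ⟨_, hd⟩ := primrecPred_mem_allPresentations
  -- Diverging outside `allPresentations` keeps the enumerated set inside it. On `D` every test
  -- halts, so the unbounded search finds a witness whenever one exists.
  let f : Presentation →. ℕ := fun P =>
    cond (decide (P ∈ allPresentations)) (Nat.rfind fun n => h (P, n)) Part.none
  have hf : Partrec f := Partrec.cond hd.to_comp
    (Partrec.rfind (p := fun P n => h (P, n)) hh.to₂) Partrec.none
  refine ⟨{P | (f P).Dom}, ⟨fun P hP => ?_, hf.dom_re⟩, fun P hP => ?_⟩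
  · by_contra hn
    have h0 : f P = Part.none := by simp [f, hn]
    rw [mem_ofPred_eq, h0] at hP
    exact hP
  · have h1 : f P = Nat.rfind fun n => h (P, n) := by simp [f, hD hP]
    rw [mem_ofPred_eq, h1]
    constructor
    · intro hdom
      obtain ⟨n, hn⟩ := Part.dom_iff_mem.1 hdom
      have h2 := Nat.rfind_spec hn
      obtain ⟨b, hb, hb'⟩ := H P hP n
      exact ⟨n, hb'.1 (Part.mem_unique hb h2)⟩
    · rintro ⟨n, hn⟩
      obtain ⟨b, hb, hb'⟩ := H P hP n
      refine Nat.rfind_dom.2 ⟨n, by rwa [hb'.2 hn] at hb, fun {m} _ => ?_⟩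
      obtain ⟨c, hc, -⟩ := H P hP m
      exact Part.dom_iff_mem.2 ⟨c, hc⟩

/-- A class of presentations is recursive in `D` if it and its complement are projections of
predicates that are decidable on `D`. -/
theorem isRecursiveIn_of_decOn {C : Set Presentation} (hD : D ⊆ allPresentations)
    {p q : Presentation → ℕ → Prop} (hp : DecOn D p) (hq : DecOn D q)
    (hpC : ∀ P ∈ D, (P ∈ C ↔ ∃ n, p P n)) (hqC : ∀ P ∈ D, (P ∉ C ↔ ∃ n, q P n)) :
    IsRecursiveIn (C ∩ D) D := by
  obtain ⟨X, hX, hXp⟩ := hp.exists_recEnum hD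
  obtain ⟨Y, hY, hYq⟩ := hq.exists_recEnum hD
  refine ⟨X, Y, hX, hY, fun P hP => ?_, ?_, fun P hP => ?_, ?_⟩
  · exact (hXp P hP.2).2 ((hpC P hP.2).1 hP.1)
  · refine eq_empty_of_forall_notMem fun P hP => hP.1.2 ⟨?_, hP.1.1⟩
    exact (hpC P hP.1.1).2 ((hXp P hP.1.1).1 hP.2)
  · exact (hYq P hP.1).2 ((hqC P hP.1).1 fun h => hP.2 ⟨h, hP.1⟩)
  · refine eq_empty_of_forall_notMem fun P hP => ?_
    exact (hqC P hP.1.2).2 ((hYq P hP.1.2).1 hP.2) hP.1.1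

/-- The value of a code, with a default for invalid codes. -/
def codeValue (γ : Type) [Primcodable γ] [Inhabited γ] (n : ℕ) : γ :=
  ((Encodable.decode n : Option γ)).getD default

theorem computable_codeValue (γ : Type) [Primcodable γ] [Inhabited γ] :
    Computable (codeValue γ) :=
  (Primrec.option_getD.comp Primrec.decode (Primrec.const default)).to_comp

theorem codeValue_encode {γ : Type} [Primcodable γ] [Inhabited γ] (c : γ) :
    codeValue γ (Encodable.encode c) = c := by
  simp [codeValue]

end DecOn

/-! ### Evaluation of words -/

/-- The value of a word under an assignment of group elements to the letters. -/
def evalWord {K : Type*} [Group K] (f : ℕ → K) (w : Word) : K :=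
  (w.map fun a => cond a.2 (f a.1) (f a.1)⁻¹).prod

section evalWord

variable {K : Type*} [Group K] (f : ℕ → K)

theorem evalWord_cons (a : ℕ × Bool) (w : Word) :
    evalWord f (a :: w) = cond a.2 (f a.1) (f a.1)⁻¹ * evalWord f w := by
  simp [evalWord]

theorem evalWord_append (u v : Word) : evalWord f (u ++ v) = evalWord f u * evalWord f v := by
  simp [evalWord]

/-- The formal inverse of a word. -/
def invWord (w : Word) : Word := (w.map fun a => (a.1, !a.2)).reverse

theorem evalWord_invWord (w : Word) : evalWord f (invWord w) = (evalWord f w)⁻¹ := by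
  induction w with
  | nil => simp [invWord, evalWord]
  | cons a w ih =>
    have h : invWord (a :: w) = invWord w ++ [(a.1, !a.2)] := by simp [invWord]
    rw [h, evalWord_append, ih, evalWord_cons f a w, mul_inv_rev]
    obtain ⟨i, _ | _⟩ := a <;> simp [evalWord]

/-- The powers of a word. -/
def powWord (w : Word) (n : ℕ) : Word := n.rec [] fun _ u => w ++ u

theorem evalWord_powWord (w : Word) (n : ℕ) : evalWord f (powWord w n) = evalWord f w ^ n := by
  induction n with
  | zero => exact (pow_zero _).symm
  | succ n ih =>
    change evalWord f (w ++ powWord w n) = _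
    rw [evalWord_append, ih, pow_succ']

end evalWord

/-- The value of a letter in the group presented by `P`; letters that are not generators are
trivial. -/
noncomputable def genValue (P : Presentation) (i : ℕ) : PresGroup P :=
  if h : i ∈ P.1 then PresentedGroup.of ⟨i, h⟩ else 1

/-- The value of a word in the group presented by `P`. -/
noncomputable def value (P : Presentation) (w : Word) : PresGroup P := evalWord (genValue P) w

/-- Remove the letters that are not generators of `P`. -/
def trim (P : Presentation) (w : Word) : Word := w.filter fun a => a.1 ∈ P.1

/-! ### Values of words and the universal property of a presented group -/

section value

variable {P : Presentation}

theorem value_nil : value P [] = 1 := rfl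

theorem value_append (u v : Word) : value P (u ++ v) = value P u * value P v :=
  evalWord_append _ _ _

theorem value_invWord (w : Word) : value P (invWord w) = (value P w)⁻¹ := evalWord_invWord _ _

theorem value_powWord (w : Word) (n : ℕ) : value P (powWord w n) = value P w ^ n :=
  evalWord_powWord _ _ _

theorem value_letter (i : ℕ) (b : Bool) :
    value P [(i, b)] = cond b (genValue P i) (genValue P i)⁻¹ := by
  simp [value, evalWord]

theorem trim_spell (v : List (Generator P × Bool)) : trim P (spell v) = spell v := by
  rw [trim, List.filter_eq_self]
  intro a ha
  obtain ⟨b, -, rfl⟩ := List.mem_map.1 ha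
  simpa using b.1.2

theorem exists_spell {w : Word} (hw : ∀ a ∈ w, a.1 ∈ P.1) :
    ∃ v : List (Generator P × Bool), spell v = w := by
  induction w with
  | nil => exact ⟨[], rfl⟩
  | cons a w ih =>
    obtain ⟨v, rfl⟩ := ih fun b hb => hw b (List.mem_cons_of_mem _ hb)
    exact ⟨(⟨a.1, hw a List.mem_cons_self⟩, a.2) :: v, rfl⟩

theorem letter_mem_of_mem_trim {w : Word} {a : ℕ × Bool} (ha : a ∈ trim P w) : a.1 ∈ P.1 := by
  simpa using (List.mem_filter.1 ha).2

theorem exists_spell_eq_trim (w : Word) :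
    ∃ v : List (Generator P × Bool), spell v = trim P w :=
  exists_spell fun _ ha => letter_mem_of_mem_trim ha

/-- Letters that are not generators have trivial value. Trimming thus turns an arbitrary word into
one on which the word problem algorithm is guaranteed to answer correctly. -/
theorem value_trim (w : Word) : value P (trim P w) = value P w := by
  induction w with
  | nil => rfl
  | cons a w ih =>
    by_cases h : a.1 ∈ P.1
    · have : trim P (a :: w) = a :: trim P w := by simp [trim, h]
      rw [this, value, evalWord_cons, ← value, ih, value, value, evalWord_cons]
    · have : trim P (a :: w) = trim P w := by simp [trim, h]
      rw [this, ih, value, value, evalWord_cons, genValue, dif_neg h]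
      cases a.2 <;> simp

theorem evalWord_spell {K : Type*} [Group K] (f : ℕ → K) (v : List (Generator P × Bool)) :
    evalWord f (spell v) = FreeGroup.lift (fun g : Generator P => f g.1) (FreeGroup.mk v) := by
  rw [FreeGroup.lift_mk, evalWord, spell, List.map_map]
  rfl

theorem wordValue_eq_value (v : List (Generator P × Bool)) :
    wordValue P v = value P (spell v) := by
  have h : PresentedGroup.mk (relators P) =
      FreeGroup.lift fun g : Generator P => genValue P g.1 := by
    ext g
    rw [FreeGroup.lift_apply_of, genValue, dif_pos g.2]
    rfl
  rw [value, evalWord_spell, ← h]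
  rfl

theorem value_surjective (g : PresGroup P) : ∃ w, value P w = g := by
  obtain ⟨x, rfl⟩ := PresentedGroup.mk_surjective (relators P) g
  obtain ⟨v, rfl⟩ := Quot.exists_rep x
  exact ⟨spell v, (wordValue_eq_value v).symm⟩

theorem value_relator (hP : P ∈ allPresentations) {r : Word} (hr : r ∈ P.2) : value P r = 1 := by
  obtain ⟨v, rfl⟩ := exists_spell (hP r hr)
  rw [← wordValue_eq_value]
  exact PresentedGroup.one_of_mem ⟨v, hr, rfl⟩

/-- The universal property of the group presented by `P`. -/
theorem exists_hom_of_relators {K : Type*} [Group K] (f : ℕ → K)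
    (hf : ∀ r ∈ P.2, evalWord f (trim P r) = 1) :
    ∃ F : PresGroup P →* K, ∀ w, F (value P w) = evalWord f (trim P w) := by
  have h : ∀ r ∈ relators P, FreeGroup.lift (fun g : Generator P => f g.1) r = 1 := by
    rintro _ ⟨v, hv, rfl⟩
    rw [← evalWord_spell, ← trim_spell, hf _ hv]
  refine ⟨PresentedGroup.toGroup h, fun w => ?_⟩
  obtain ⟨v, hv⟩ := exists_spell_eq_trim (P := P) w
  rw [← value_trim, ← hv, ← wordValue_eq_value, evalWord_spell]
  rfl

theorem fg_presGroup : Group.FG (PresGroup P) := by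
  have : Finite (Generator P) := Finite.of_fintype {i // i ∈ P.1}
  exact Group.fg_of_surjective (PresentedGroup.mk_surjective (relators P))

theorem closure_letters (P : Presentation) :
    Subgroup.closure (genValue P '' {i | i ∈ P.1}) = ⊤ := by
  rw [eq_top_iff]
  intro g _
  obtain ⟨w, rfl⟩ := value_surjective g
  rw [← value_trim]
  have : ∀ w : Word, (∀ a ∈ w, a.1 ∈ P.1) →
      value P w ∈ Subgroup.closure (genValue P '' {i | i ∈ P.1}) := by
    intro w hw
    induction w with
    | nil => exact one_mem _
    | cons a w ih =>
      rw [value, evalWord_cons]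
      refine mul_mem ?_ (ih fun b hb => hw b (List.mem_cons_of_mem _ hb))
      have h1 : genValue P a.1 ∈ Subgroup.closure (genValue P '' {i | i ∈ P.1}) :=
        Subgroup.subset_closure ⟨a.1, hw a List.mem_cons_self, rfl⟩
      cases a.2
      · exact inv_mem h1
      · exact h1
  exact this _ fun _ ha => letter_mem_of_mem_trim ha

end value

/-! ### Cocycles given by finite tables -/

/-- A finite table of values of an integral cocycle, as differences of natural numbers. -/
abbrev CocycleTable : Type := List ((ℕ × Bool) × (ℕ × ℕ))

/-- States of the automaton: an integer, as a difference of natural numbers, and a coset. -/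
abbrev RunState : Type := (ℕ × ℕ) × Bool

/-- Look up a value in a table. -/
def weight (T : CocycleTable) (k : ℕ × Bool) : ℕ × ℕ := (T.lookup k).getD (0, 0)

/-- The action of a letter on the states. -/
def stepState (ε : List ℕ) (T : CocycleTable) (a : ℕ × Bool) (q : RunState) : RunState :=
  -- A letter and its inverse change the coset in the same way; the inverse subtracts the weight
  -- attached to the coset it arrives in.
  let e := xor q.2 (decide (a.1 ∈ ε))
  cond a.2 ((q.1.1 + (weight T (a.1, q.2)).1, q.1.2 + (weight T (a.1, q.2)).2), e)
    ((q.1.1 + (weight T (a.1, e)).2, q.1.2 + (weight T (a.1, e)).1), e)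

/-- The action of a word on the states. -/
def runWord (ε : List ℕ) (T : CocycleTable) (w : Word) (q : RunState) : RunState :=
  w.foldr (stepState ε T) q

/-- The state with integer zero and the given coset. -/
def zeroState (e : Bool) : RunState := ((0, 0), e)

/-- The table defines an action of the group presented by `P`. -/
def IsCocycle (P : Presentation) (ε : List ℕ) (T : CocycleTable) : Prop :=
  ∀ r ∈ P.2, ∀ e ∈ [false, true],
    (runWord ε T (trim P r) (zeroState e)).1.1 = (runWord ε T (trim P r) (zeroState e)).1.2 ∧
      (runWord ε T (trim P r) (zeroState e)).2 = e

/-- The value of a state. -/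
def stateValue (q : RunState) : ℤ × Bool := ((q.1.1 : ℤ) - q.1.2, q.2)

/-- A skew translation of `ℤ × Bool`. -/
def skewPerm (c : Bool → ℤ) (d : Bool) : Equiv.Perm (ℤ × Bool) where
  toFun x := (x.1 + c x.2, xor x.2 d)
  invFun x := (x.1 - c (xor x.2 d), xor x.2 d)
  left_inv x := by simp
  right_inv x := by simp

/-- The integral values of a table. -/
def tableValue (T : CocycleTable) (i : ℕ) (e : Bool) : ℤ :=
  ((weight T (i, e)).1 : ℤ) - (weight T (i, e)).2

/-- The permutation assigned to a letter. -/
def tablePerm (ε : List ℕ) (T : CocycleTable) (i : ℕ) : Equiv.Perm (ℤ × Bool) :=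
  skewPerm (tableValue T i) (decide (i ∈ ε))

theorem stateValue_runWord (ε : List ℕ) (T : CocycleTable) (w : Word) (q : RunState) :
    stateValue (runWord ε T w q) = evalWord (tablePerm ε T) w (stateValue q) := by
  induction w with
  | nil => rfl
  | cons a w ih =>
    rw [evalWord_cons, Equiv.Perm.mul_apply, ← ih]
    change stateValue (stepState ε T a (runWord ε T w q)) = _
    generalize runWord ε T w q = q
    obtain ⟨i, _ | _⟩ := a
    · change _ = (tablePerm ε T i).symm _
      simp only [stepState, stateValue, tablePerm, skewPerm, tableValue, Equiv.coe_fn_symm_mk,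
        cond_false]
      refine Prod.ext ?_ rfl
      push_cast; ring
    · simp only [stepState, stateValue, tablePerm, skewPerm, tableValue, Equiv.coe_fn_mk,
        cond_true]
      refine Prod.ext ?_ rfl
      push_cast; ring

/-- The action commutes with translations of `ℤ`. For this reason `IsCocycle` tests each relator at
only two states. -/
theorem evalWord_tablePerm_add (ε : List ℕ) (T : CocycleTable) (w : Word) (m k : ℤ) (e : Bool) :
    evalWord (tablePerm ε T) w (m + k, e) =
      ((evalWord (tablePerm ε T) w (m, e)).1 + k, (evalWord (tablePerm ε T) w (m, e)).2) := by
  induction w with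
  | nil => rfl
  | cons a w ih =>
    rw [evalWord_cons, Equiv.Perm.mul_apply, Equiv.Perm.mul_apply, ih]
    generalize evalWord (tablePerm ε T) w (m, e) = x
    obtain ⟨i, _ | _⟩ := a
    · change (tablePerm ε T i).symm _ = (((tablePerm ε T i).symm x).1 + k, _)
      simp only [tablePerm, skewPerm, Equiv.coe_fn_symm_mk]
      refine Prod.ext ?_ rfl
      simp only
      ring
    · simp only [tablePerm, skewPerm, Equiv.coe_fn_mk, cond_true]
      refine Prod.ext ?_ rfl
      simp only
      ring

/-- A table satisfying the relations defines a homomorphism. -/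
theorem IsCocycle.exists_hom {P : Presentation} {ε : List ℕ} {T : CocycleTable}
    (h : IsCocycle P ε T) : ∃ F : PresGroup P →* Equiv.Perm (ℤ × Bool),
      (∀ w q, F (value P w) (stateValue q) = stateValue (runWord ε T (trim P w) q)) ∧
      ∀ g m k e, F g (m + k, e) = ((F g (m, e)).1 + k, (F g (m, e)).2) := by
  obtain ⟨F, hF⟩ := exists_hom_of_relators (P := P) (tablePerm ε T) (by
    intro r hr
    ext1 x
    obtain ⟨m, e⟩ := x
    have h1 : e ∈ [false, true] := by cases e <;> simp
    obtain ⟨h2, h3⟩ := h r hr e h1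
    have h4 := stateValue_runWord ε T (trim P r) (zeroState e)
    have h5 : stateValue (runWord ε T (trim P r) (zeroState e)) = (0, e) := by
      simp [stateValue, h2, h3]
    have h6 : stateValue (zeroState e) = (0, e) := by simp [stateValue, zeroState]
    have h7 := evalWord_tablePerm_add ε T (trim P r) 0 m e
    rw [h5, h6] at h4
    rw [zero_add, ← h4, zero_add] at h7
    exact h7)
  refine ⟨F, fun w q => by rw [hF, stateValue_runWord], fun g m k e => ?_⟩
  obtain ⟨w, rfl⟩ := value_surjective g
  rw [hF]
  exact evalWord_tablePerm_add ε T _ m k e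

/-- `ψ` translates the trivial coset by `m`. -/
def ShiftsBy (ψ : Equiv.Perm (ℤ × Bool)) (m : ℤ) : Prop := ∀ k, ψ (k, false) = (k + m, false)

theorem ShiftsBy.mul {ψ χ : Equiv.Perm (ℤ × Bool)} {m n : ℤ} (hψ : ShiftsBy ψ m)
    (hχ : ShiftsBy χ n) : ShiftsBy (ψ * χ) (m + n) := fun k => by
  rw [Equiv.Perm.mul_apply, hχ, hψ]; congr 1; ring

theorem ShiftsBy.inv {ψ : Equiv.Perm (ℤ × Bool)} {m : ℤ} (hψ : ShiftsBy ψ m) :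
    ShiftsBy ψ⁻¹ (-m) := fun k => by
  rw [Equiv.Perm.inv_eq_iff_eq, hψ, neg_add_cancel_right]

theorem ShiftsBy.one : ShiftsBy 1 0 := fun k => by simp

theorem ShiftsBy.unique {ψ : Equiv.Perm (ℤ × Bool)} {m n : ℤ} (hm : ShiftsBy ψ m)
    (hn : ShiftsBy ψ n) : m = n := by
  have := (hm 0).symm.trans (hn 0)
  simpa using this

theorem ShiftsBy.zpow {ψ : Equiv.Perm (ℤ × Bool)} {m : ℤ} (hψ : ShiftsBy ψ m) (n : ℤ) :
    ShiftsBy (ψ ^ n) (n * m) := by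
  induction n using Int.induction_on with
  | zero => simpa using ShiftsBy.one
  | succ n ih =>
    rw [zpow_add_one, add_mul, one_mul]
    exact ih.mul hψ
  | pred n ih =>
    rw [zpow_sub_one, sub_mul, one_mul, sub_eq_add_neg]
    exact ih.mul hψ.inv

/-- By translation equivariance, a word that returns the zero state to the trivial coset translates
that whole coset by the final counter. -/
theorem IsCocycle.exists_shift_hom {P : Presentation} {ε : List ℕ} {T : CocycleTable}
    (h : IsCocycle P ε T) : ∃ F : PresGroup P →* Equiv.Perm (ℤ × Bool),
      ∀ w, (runWord ε T (trim P w) (zeroState false)).2 = false →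
        ShiftsBy (F (value P w)) (stateValue (runWord ε T (trim P w) (zeroState false))).1 := by
  obtain ⟨F, hF, hF'⟩ := h.exists_hom
  refine ⟨F, fun w hw k => ?_⟩
  have h1 := hF w (zeroState false)
  have h2 := hF' (value P w) 0 k false
  have h3 : stateValue (zeroState false) = (0, false) := rfl
  rw [zero_add, ← h3, h1] at h2
  rw [h2, add_comm]
  refine Prod.ext rfl ?_
  exact hw

/-! ### The cocycle of a subgroup of index at most two -/

section cosets

variable {G : Type*} [Group G] {H : Subgroup G}

open Classical in
/-- The coset of an element with respect to a subgroup of index at most two. -/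
noncomputable def cosetBit (H : Subgroup G) (g : G) : Bool := decide (g ∉ H)

theorem cosetBit_eq_false {g : G} : cosetBit H g = false ↔ g ∈ H := by simp [cosetBit]

theorem inv_mul_mem_iff_of_cosets {s : G} (hs : ∀ g, g ∈ H ∨ s⁻¹ * g ∈ H) (g h : G) :
    g⁻¹ * h ∈ H ↔ cosetBit H g = cosetBit H h := by
  have key : ∀ g, g ∉ H → s⁻¹ * g ∈ H := fun g hg => (hs g).resolve_left hg
  by_cases hg : g ∈ H
  · rw [cosetBit_eq_false.2 hg, eq_comm, cosetBit_eq_false, Subgroup.mul_mem_cancel_left _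
      (inv_mem hg)]
  · by_cases hh : h ∈ H
    · rw [cosetBit_eq_false.2 hh, cosetBit_eq_false, Subgroup.mul_mem_cancel_right _ hh,
        inv_mem_iff]
    · have h1 : cosetBit H g = true := by simp [cosetBit, hg]
      have h2 : cosetBit H h = true := by simp [cosetBit, hh]
      rw [h1, h2]
      simp only [iff_true]
      have := mul_mem (inv_mem (key g hg)) (key h hh)
      simpa [mul_assoc] using this

theorem cosetBit_inv (g : G) : cosetBit H g⁻¹ = cosetBit H g := by simp [cosetBit]

theorem cosetBit_mul {s : G} (hs : ∀ g, g ∈ H ∨ s⁻¹ * g ∈ H) (g h : G) :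
    cosetBit H (g * h) = xor (cosetBit H g) (cosetBit H h) := by
  have h1 := inv_mul_mem_iff_of_cosets hs g⁻¹ h
  rw [inv_inv, cosetBit_inv, ← cosetBit_eq_false] at h1
  cases hg : cosetBit H g <;> cases hh : cosetBit H h <;> cases hgh : cosetBit H (g * h) <;>
    simp_all

open Classical in
/-- A section of the map to the cosets. -/
noncomputable def cosetSection (H : Subgroup G) (e : Bool) : G :=
  if h : e = true ∧ ∃ g, g ∉ H then h.2.choose else 1

theorem cosetSection_false : cosetSection H false = 1 := dif_neg (by simp)

theorem cosetBit_cosetSection (hH : ∃ g, g ∉ H) (e : Bool) :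
    cosetBit H (cosetSection H e) = e := by
  cases e
  · rw [cosetSection_false, cosetBit_eq_false]
    exact one_mem H
  · rw [cosetSection, dif_pos ⟨rfl, hH⟩]
    simpa [cosetBit] using hH.choose_spec

/-- These are the Schreier elements of `H`. If `H` is the whole group, the section is constantly `1`
and there is nothing to check. -/
theorem cosetSection_conj_mem {s : G} (hs : ∀ g, g ∈ H ∨ s⁻¹ * g ∈ H) (g : G) (e : Bool) :
    (cosetSection H (xor e (cosetBit H g)))⁻¹ * (g * cosetSection H e) ∈ H := by
  by_cases hH : ∃ g, g ∉ H
  · rw [inv_mul_mem_iff_of_cosets hs, cosetBit_mul hs, cosetBit_cosetSection hH,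
      cosetBit_cosetSection hH, Bool.xor_comm]
  · push Not at hH
    exact hH _

/-- The cocycle induced by a homomorphism on a subgroup of index at most two. -/
noncomputable def inducedCocycle {s : G} (hs : ∀ g, g ∈ H ∨ s⁻¹ * g ∈ H) (h : H →* CycInf)
    (g : G) (e : Bool) : ℤ :=
  Multiplicative.toAdd (h ⟨_, cosetSection_conj_mem hs g e⟩)

variable {s : G} (hs : ∀ g, g ∈ H ∨ s⁻¹ * g ∈ H) (h : H →* CycInf)

/-- The Schreier elements telescope: the section at the intermediate coset cancels. -/
theorem inducedCocycle_mul (g g' : G) (e : Bool) : inducedCocycle hs h (g * g') e =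
    inducedCocycle hs h g (xor e (cosetBit H g')) + inducedCocycle hs h g' e := by
  rw [inducedCocycle, inducedCocycle, inducedCocycle, ← toAdd_mul, ← map_mul]
  congr 2
  apply Subtype.ext
  change _ = (_ : G) * _
  have h1 : xor (xor e (cosetBit H g')) (cosetBit H g) = xor e (cosetBit H (g * g')) := by
    rw [cosetBit_mul hs, Bool.xor_assoc, Bool.xor_comm (cosetBit H g')]
  simp only [h1]
  group

theorem cosetBit_one : cosetBit H 1 = false := cosetBit_eq_false.2 (one_mem H)

theorem inducedCocycle_one (e : Bool) : inducedCocycle hs h 1 e = 0 := by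
  have := inducedCocycle_mul hs h 1 1 e
  rw [mul_one, cosetBit_one, Bool.xor_false] at this
  linarith

theorem inducedCocycle_inv (g : G) (e : Bool) :
    inducedCocycle hs h g⁻¹ (xor e (cosetBit H g)) = -inducedCocycle hs h g e := by
  have := inducedCocycle_mul hs h g⁻¹ g e
  rw [inv_mul_cancel, inducedCocycle_one] at this
  linarith

theorem inducedCocycle_of_mem {g : G} (hg : g ∈ H) :
    inducedCocycle hs h g false = Multiplicative.toAdd (h ⟨g, hg⟩) := by
  rw [inducedCocycle]
  congr 2
  apply Subtype.ext
  simp [cosetBit_eq_false.2 hg, cosetSection_false]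

end cosets

/-- The generators of `P` outside a subgroup. -/
noncomputable def oddGenerators (P : Presentation) (H : Subgroup (PresGroup P)) : List ℕ :=
  P.1.filter fun i => cosetBit H (genValue P i)

theorem decide_mem_oddGenerators {P : Presentation} (H : Subgroup (PresGroup P)) {i : ℕ}
    (hi : i ∈ P.1) : decide (i ∈ oddGenerators P H) = cosetBit H (genValue P i) := by
  rw [Bool.eq_iff_iff]
  simp [oddGenerators, hi]

theorem runWord_oddGenerators_snd {P : Presentation} {H : Subgroup (PresGroup P)}
    {s : PresGroup P} (hs : ∀ g, g ∈ H ∨ s⁻¹ * g ∈ H) (T : CocycleTable) {w : Word}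
    (hw : ∀ a ∈ w, a.1 ∈ P.1) (q : RunState) :
    (runWord (oddGenerators P H) T w q).2 = xor q.2 (cosetBit H (value P w)) := by
  induction w with
  | nil => simp [runWord, value_nil, cosetBit_one]
  | cons a w ih =>
    have ih := ih fun b hb => hw b (List.mem_cons_of_mem _ hb)
    have hd := decide_mem_oddGenerators H (hw a List.mem_cons_self)
    have h1 : (runWord (oddGenerators P H) T (a :: w) q).2 =
        xor (runWord (oddGenerators P H) T w q).2 (decide (a.1 ∈ oddGenerators P H)) := by
      change (stepState _ T a _).2 = _
      simp only [stepState]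
      cases a.2 <;> rfl
    have h2 : cosetBit H (value P (a :: w)) =
        xor (cosetBit H (genValue P a.1)) (cosetBit H (value P w)) := by
      rw [value, evalWord_cons, cosetBit_mul hs]
      cases a.2
      · rw [cond_false, cosetBit_inv]; rfl
      · rfl
    rw [h1, h2, ih, hd, Bool.xor_assoc, Bool.xor_comm (cosetBit H (value P w))]

/-- The table of the cocycle induced by a homomorphism on a subgroup of index at most two. -/
noncomputable def inducedTable {P : Presentation} {H : Subgroup (PresGroup P)}
    {s : PresGroup P} (hs : ∀ g, g ∈ H ∨ s⁻¹ * g ∈ H) (h : H →* CycInf) : CocycleTable :=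
  (P.1.flatMap fun i => [(i, false), (i, true)]).map fun k =>
    (k, ((inducedCocycle hs h (genValue P k.1) k.2).toNat,
      (-inducedCocycle hs h (genValue P k.1) k.2).toNat))

theorem tableValue_inducedTable {P : Presentation} {H : Subgroup (PresGroup P)}
    {s : PresGroup P} (hs : ∀ g, g ∈ H ∨ s⁻¹ * g ∈ H) (h : H →* CycInf) {i : ℕ} (hi : i ∈ P.1)
    (e : Bool) : tableValue (inducedTable hs h) i e = inducedCocycle hs h (genValue P i) e := by
  have hk : (i, e) ∈ P.1.flatMap fun i => [(i, false), (i, true)] := by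
    rw [List.mem_flatMap]
    exact ⟨i, hi, by cases e <;> simp⟩
  rw [tableValue, weight, inducedTable, List.lookup_graph _ hk, Option.getD_some]
  exact Int.toNat_sub_toNat_neg _

/-- The automaton only knows the cocycle on generators; the cocycle identity propagates this to all
words. -/
theorem stateValue_runWord_inducedTable {P : Presentation} {H : Subgroup (PresGroup P)}
    {s : PresGroup P} (hs : ∀ g, g ∈ H ∨ s⁻¹ * g ∈ H) (h : H →* CycInf) {w : Word}
    (hw : ∀ a ∈ w, a.1 ∈ P.1) (q : RunState) :
    stateValue (runWord (oddGenerators P H) (inducedTable hs h) w q) =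
      ((stateValue q).1 + inducedCocycle hs h (value P w) q.2,
        xor q.2 (cosetBit H (value P w))) := by
  refine Prod.ext ?_ (runWord_oddGenerators_snd hs _ hw q)
  induction w with
  | nil => simp [runWord, value_nil, inducedCocycle_one]
  | cons a w ih =>
    have hw' : ∀ a ∈ w, a.1 ∈ P.1 := fun b hb => hw b (List.mem_cons_of_mem _ hb)
    have ih := ih hw'
    have hi := hw a List.mem_cons_self
    have hd := decide_mem_oddGenerators H hi
    have h2 := runWord_oddGenerators_snd hs (inducedTable hs h) hw' q
    have hT := tableValue_inducedTable hs h hi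
    simp only [tableValue] at hT
    change (stateValue (stepState _ _ a (runWord _ _ w q))).1 = _
    generalize runWord (oddGenerators P H) (inducedTable hs h) w q = q' at *
    obtain ⟨i, _ | _⟩ := a
    · have hv : value P ((i, false) :: w) = (genValue P i)⁻¹ * value P w := evalWord_cons _ _ _
      rw [hv, inducedCocycle_mul, ← h2]
      have h4 := inducedCocycle_inv hs h (genValue P i) (xor q'.2 (cosetBit H (genValue P i)))
      rw [Bool.xor_assoc, Bool.xor_self, Bool.xor_false, ← hT, ← hd] at h4
      rw [h4]
      simp only [stepState, cond_false, stateValue] at ih ⊢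
      push_cast
      linarith
    · have hv : value P ((i, true) :: w) = genValue P i * value P w := evalWord_cons _ _ _
      rw [hv, inducedCocycle_mul, ← h2]
      have h4 := hT q'.2
      simp only at h4
      rw [← h4]
      simp only [stepState, cond_true, stateValue] at ih ⊢
      push_cast
      linarith

/-- Relators have trivial value, where cocycle and parity vanish. Hence every homomorphism to `ℤ`
from a subgroup of index at most two is recorded by a finite table. -/
theorem isCocycle_inducedTable {P : Presentation} (hP : P ∈ allPresentations)
    {H : Subgroup (PresGroup P)} {s : PresGroup P} (hs : ∀ g, g ∈ H ∨ s⁻¹ * g ∈ H)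
    (h : H →* CycInf) : IsCocycle P (oddGenerators P H) (inducedTable hs h) := by
  intro r hr e _
  have h1 := stateValue_runWord_inducedTable hs h (w := trim P r)
    (fun _ ha => letter_mem_of_mem_trim ha) (zeroState e)
  rw [value_trim, value_relator hP hr, inducedCocycle_one, cosetBit_one] at h1
  have h2 := congrArg Prod.fst h1
  have h3 := congrArg Prod.snd h1
  simp only [stateValue, zeroState] at h2 h3
  constructor
  · have : ((runWord (oddGenerators P H) (inducedTable hs h) (trim P r) (zeroState e)).1.1 : ℤ) =
        (runWord (oddGenerators P H) (inducedTable hs h) (trim P r) (zeroState e)).1.2 := by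
      rw [zeroState]; push_cast at h2; linarith
    exact_mod_cast this
  · rw [zeroState, h3, Bool.xor_false]

theorem stateValue_runWord_of_mem {P : Presentation} {H : Subgroup (PresGroup P)}
    {s : PresGroup P} (hs : ∀ g, g ∈ H ∨ s⁻¹ * g ∈ H) (h : H →* CycInf) {w : Word}
    (hw : value P w ∈ H) :
    stateValue (runWord (oddGenerators P H) (inducedTable hs h) (trim P w) (zeroState false)) =
      (Multiplicative.toAdd (h ⟨_, hw⟩), false) := by
  rw [stateValue_runWord_inducedTable hs h fun _ ha => letter_mem_of_mem_trim ha]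
  simp only [value_trim]
  refine Prod.ext ?_ ?_
  · change ((0 : ℕ) : ℤ) - (0 : ℕ) + inducedCocycle hs h (value P w) false = _
    rw [inducedCocycle_of_mem hs h hw]; simp
  · simp [zeroState, cosetBit_eq_false.2 hw]

theorem weight_nil (k : ℕ × Bool) : weight [] k = (0, 0) := rfl

theorem runWord_nil_fst (ε : List ℕ) (w : Word) (q : RunState) : (runWord ε [] w q).1 = q.1 := by
  induction w with
  | nil => rfl
  | cons a w ih =>
    change (stepState ε [] a (runWord ε [] w q)).1 = _
    rw [← ih]
    simp only [stepState, weight_nil, add_zero]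
    cases a.2 <;> rfl

/-- With the empty table the counter stays constant and only parity is tested, so the lists `ε`
encode candidates for subgroups of index at most two. -/
theorem isCocycle_nil_oddGenerators {P : Presentation} (hP : P ∈ allPresentations)
    {H : Subgroup (PresGroup P)} {s : PresGroup P} (hs : ∀ g, g ∈ H ∨ s⁻¹ * g ∈ H) :
    IsCocycle P (oddGenerators P H) [] := by
  intro r hr e _
  constructor
  · rw [runWord_nil_fst]; rfl
  · rw [runWord_oddGenerators_snd hs [] fun _ ha => letter_mem_of_mem_trim ha, value_trim,
      value_relator hP hr, cosetBit_one, Bool.xor_false]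
    rfl

/-! ### Certificates for cyclic-by-two groups -/

/-- The value of `u` is a power of the value of `t` with exponent of absolute value less
than `N`. -/
def IsPowerBelow (P : Presentation) (t : Word) (N : ℕ) (u : Word) : Prop :=
  ∃ k ∈ List.range N, value P (u ++ powWord t k) = 1 ∨ value P (u ++ invWord (powWord t k)) = 1

/-- The action of a word on the trivial coset of the automaton. -/
def runTrim (P : Presentation) (ε : List ℕ) (T : CocycleTable) (w : Word) : RunState :=
  runWord ε T (trim P w) (zeroState false)

/-- A translation of `ℤ × Bool` shows that `t` has infinite order. -/
def IsTranslation (P : Presentation) (ε : List ℕ) (T : CocycleTable) (t : Word) : Prop :=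
  (runTrim P ε T t).2 = false ∧ (runTrim P ε T t).1.1 ≠ (runTrim P ε T t).1.2

/-- The cosets of `1` and `s` with respect to the powers of `t` are permuted by the letters. -/
def PermutesCosets (P : Presentation) (t s : Word) (N : ℕ) : Prop :=
  ∀ i ∈ P.1, ∀ b ∈ [false, true], ∀ u ∈ [[], s],
    IsPowerBelow P t N ((i, b) :: u) ∨ IsPowerBelow P t N (invWord s ++ (i, b) :: u)

/-- A finite certificate for being cyclic-by-two. -/
structure CyclicCertificate (P : Presentation) (ε : List ℕ) (T : CocycleTable) (t s : Word)
    (N : ℕ) : Prop where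
  isCocycle : IsCocycle P ε T
  isTranslation : IsTranslation P ε T t
  permutesCosets : PermutesCosets P t s N

section certificates

variable {P : Presentation}

theorem IsPowerBelow.mem_zpowers {t u : Word} {N : ℕ} (h : IsPowerBelow P t N u) :
    value P u ∈ Subgroup.zpowers (value P t) := by
  obtain ⟨k, -, h | h⟩ := h
  · rw [value_append, value_powWord] at h
    rw [eq_inv_of_mul_eq_one_left h]
    exact inv_mem (Subgroup.npow_mem_zpowers _ _)
  · rw [value_append, value_invWord, value_powWord, mul_inv_eq_one] at h
    rw [h]
    exact Subgroup.npow_mem_zpowers _ _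

/-- Stated for all large bounds so that finitely many such conditions can share one `N`. -/
theorem eventually_isPowerBelow {t u : Word} (h : value P u ∈ Subgroup.zpowers (value P t)) :
    ∀ᶠ N in Filter.atTop, IsPowerBelow P t N u := by
  obtain ⟨n, hn⟩ := Subgroup.mem_zpowers_iff.1 h
  filter_upwards [Filter.eventually_gt_atTop n.natAbs] with N hN
  refine ⟨n.natAbs, List.mem_range.2 hN, ?_⟩
  rw [value_append, value_append, value_invWord, value_powWord, ← hn, ← zpow_natCast]
  obtain h | h := n.natAbs_eq
  · right
    rw [← h, mul_inv_cancel]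
  · left
    rw [← zpow_add, show n + (n.natAbs : ℤ) = 0 by omega, zpow_zero]

theorem value_cons (a : ℕ × Bool) (w : Word) :
    value P (a :: w) = value P [a] * value P w := by
  rw [← value_append, List.singleton_append]

theorem IsCocycle.exists_translation {ε : List ℕ} {T : CocycleTable} (h : IsCocycle P ε T) :
    ∃ F : PresGroup P →* Equiv.Perm (ℤ × Bool),
      (∀ w, IsTranslation P ε T w → ∃ m ≠ 0, ShiftsBy (F (value P w)) m) ∧
      ∀ w, (runTrim P ε T w).2 = false → (runTrim P ε T w).1.1 = (runTrim P ε T w).1.2 →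
        ShiftsBy (F (value P w)) 0 := by
  obtain ⟨F, hF⟩ := h.exists_shift_hom
  refine ⟨F, fun w hw => ⟨_, ?_, hF w hw.1⟩, fun w hw h0 => ?_⟩
  · have := hw.2
    change ((runTrim P ε T w).1.1 : ℤ) - (runTrim P ε T w).1.2 ≠ 0
    omega
  · have h1 := hF w hw
    change ShiftsBy _ (((runTrim P ε T w).1.1 : ℤ) - (runTrim P ε T w).1.2) at h1
    rwa [h0, sub_self] at h1

/-- A set that contains an element and is stable under the letters contains all words. -/
theorem value_mul_mem_of_letters {S : Set (PresGroup P)} {g : PresGroup P} (hg : g ∈ S)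
    (hS : ∀ i ∈ P.1, ∀ b ∈ [false, true], ∀ x ∈ S, value P [(i, b)] * x ∈ S) (w : Word) :
    value P w * g ∈ S := by
  rw [← value_trim]
  have hw : ∀ a ∈ trim P w, a.1 ∈ P.1 := fun a ha => letter_mem_of_mem_trim ha
  generalize trim P w = w at hw
  induction w with
  | nil => rwa [value_nil, one_mul]
  | cons a w ih =>
    rw [value_cons, mul_assoc]
    obtain ⟨i, b⟩ := a
    exact hS i (hw _ List.mem_cons_self) b (by cases b <;> simp) _
      (ih fun b hb => hw b (List.mem_cons_of_mem _ hb))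

/-- The action gives `t` infinite order. The union of the cosets of `1` and `s` contains `1` and is
stable under the letters, so it is everything. -/
theorem CyclicCertificate.isCyclicByTwo {ε : List ℕ} {T : CocycleTable} {t s : Word} {N : ℕ}
    (h : CyclicCertificate P ε T t s N) : IsCyclicByTwo (PresGroup P) := by
  obtain ⟨F, hF, -⟩ := h.isCocycle.exists_translation
  obtain ⟨m, hm, hFt⟩ := hF t h.isTranslation
  have ht : ∀ n : ℤ, value P t ^ n = 1 → n = 0 := fun n hn => by
    have h1 := hFt.zpow n
    rw [← map_zpow, hn, map_one] at h1
    exact (mul_eq_zero.1 (h1.unique ShiftsBy.one)).resolve_right hm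
  have hS : ∀ g, g ∈ Subgroup.zpowers (value P t) ∨
      (value P s)⁻¹ * g ∈ Subgroup.zpowers (value P t) := by
    intro g
    obtain ⟨w, rfl⟩ := value_surjective g
    rw [← mul_one (value P w)]
    refine value_mul_mem_of_letters (S := {g | g ∈ Subgroup.zpowers (value P t) ∨
      (value P s)⁻¹ * g ∈ Subgroup.zpowers (value P t)}) (Or.inl (one_mem _)) ?_ w
    have key : ∀ i ∈ P.1, ∀ b ∈ [false, true], ∀ u ∈ [[], s], ∀ x,
        (value P u)⁻¹ * x ∈ Subgroup.zpowers (value P t) →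
        value P [(i, b)] * x ∈ Subgroup.zpowers (value P t) ∨
        (value P s)⁻¹ * (value P [(i, b)] * x) ∈ Subgroup.zpowers (value P t) := by
      intro i hi b hb u hu x hx
      refine (h.permutesCosets i hi b hb u hu).imp (fun h => ?_) fun h => ?_
      · have := mul_mem h.mem_zpowers hx
        rw [value_cons] at this
        simpa [mul_assoc] using this
      · have := mul_mem h.mem_zpowers hx
        rw [value_append, value_cons, value_invWord] at this
        simpa [mul_assoc] using this
    rintro i hi b hb x (hx | hx)
    · exact key i hi b hb [] (by simp) x (by rwa [value_nil, inv_one, one_mul])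
    · exact key i hi b hb s (by simp) x hx
  obtain ⟨h0, h2⟩ := index_le_two_of_cosets _ hS
  exact ⟨_, h0, h2, nonempty_zpowers_equiv ht⟩

theorem isTranslation_inducedTable {H : Subgroup (PresGroup P)} {s : PresGroup P}
    (hs : ∀ g, g ∈ H ∨ s⁻¹ * g ∈ H) (h : H →* CycInf) {w : Word} (hw : value P w ∈ H)
    (hne : h ⟨value P w, hw⟩ ≠ 1) : IsTranslation P (oddGenerators P H) (inducedTable hs h) w := by
  have h1 := stateValue_runWord_of_mem hs h hw
  refine ⟨congrArg Prod.snd h1, fun h2 => hne ?_⟩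
  have h3 := congrArg Prod.fst h1
  change ((runTrim P _ (inducedTable hs h) w).1.1 : ℤ) -
    (runTrim P _ (inducedTable hs h) w).1.2 = _ at h3
  rw [h2, sub_self] at h3
  exact h3.symm

/-- The table is induced by an isomorphism from the powers of `t` to `ℤ`, under which `t` is not
trivial. -/
theorem exists_cyclicCertificate (hP : P ∈ allPresentations) (h : IsCyclicByTwo (PresGroup P)) :
    ∃ ε T t s N, CyclicCertificate P ε T t s N := by
  obtain ⟨t, ht, h0, h2⟩ := h.exists_generator
  obtain ⟨s, hs⟩ := exists_coset_rep_of_index_le_two h0 h2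
  obtain ⟨t, rfl⟩ := value_surjective t
  obtain ⟨s, rfl⟩ := value_surjective s
  obtain ⟨e⟩ := nonempty_zpowers_equiv ht
  have hN : ∀ᶠ N in Filter.atTop, PermutesCosets P t s N := by
    unfold PermutesCosets
    refine (Filter.eventually_all_finite (List.finite_toSet P.1)).2 fun i _ => ?_
    refine (Filter.eventually_all_finite (List.finite_toSet [false, true])).2 fun b _ => ?_
    refine (Filter.eventually_all_finite (List.finite_toSet [[], s])).2 fun u _ => ?_
    obtain h | h := hs (value P ((i, b) :: u))
    · filter_upwards [eventually_isPowerBelow h] with N hN using Or.inl hN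
    · rw [← value_invWord, ← value_append] at h
      filter_upwards [eventually_isPowerBelow h] with N hN using Or.inr hN
  obtain ⟨N, hN⟩ := hN.exists
  refine ⟨_, _, t, s, N, isCocycle_inducedTable hP hs e.toMonoidHom,
    isTranslation_inducedTable hs _ (Subgroup.mem_zpowers _) fun h1 => ?_, hN⟩
  have h3 := e.injective (h1.trans (map_one e).symm)
  have h4 := ht 1 (by rw [zpow_one]; exact congrArg Subtype.val h3)
  exact one_ne_zero h4

/-! ### Certificates for not being cyclic-by-two -/

/-- The values of the words in `L` exhaust the group. -/
def Exhausts (P : Presentation) (L : List Word) : Prop :=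
  L ≠ [] ∧ ∀ u ∈ L, ∀ i ∈ P.1, ∀ b ∈ [false, true], ∃ v ∈ L,
    value P ((i, b) :: u ++ invWord v) = 1

/-- A nonempty set stable under left multiplication by all letters is the whole group. -/
theorem Exhausts.finite {L : List Word} (h : Exhausts P L) : Finite (PresGroup P) := by
  obtain ⟨u, hu⟩ := List.exists_mem_of_ne_nil _ h.1
  have hfin : (value P '' {v | v ∈ L}).Finite := (List.finite_toSet L).image _
  have : ∀ g, g ∈ value P '' {v | v ∈ L} := by
    intro g
    obtain ⟨w, hw⟩ := value_surjective (g * (value P u)⁻¹)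
    rw [← inv_mul_cancel_right g (value P u), ← hw]
    refine value_mul_mem_of_letters (S := value P '' {v | v ∈ L}) ⟨u, hu, rfl⟩ ?_ w
    rintro i hi b hb _ ⟨u, hu, rfl⟩
    obtain ⟨v, hv, hv'⟩ := h.2 u hu i hi b hb
    refine ⟨v, hv, ?_⟩
    rw [value_append, value_invWord, mul_inv_eq_one] at hv'
    rw [← hv', value_cons]
  exact Set.finite_univ_iff.1 (hfin.subset fun g _ => this g)

theorem exists_exhausts [Finite (PresGroup P)] : ∃ L, Exhausts P L := by
  have := Fintype.ofFinite (PresGroup P)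
  choose f hf using value_surjective (P := P)
  have hmem : ∀ g, f g ∈ (Finset.univ.toList (α := PresGroup P)).map f := fun g =>
    List.mem_map.2 ⟨g, by simp, rfl⟩
  refine ⟨_, List.ne_nil_of_mem (hmem 1), fun u _ i _ b _ => ⟨_, hmem (value P ((i, b) :: u)), ?_⟩⟩
  rw [value_append, value_invWord, hf, mul_inv_cancel]

theorem IsCyclicByTwo.infinite {G : Type*} [Group G] (h : IsCyclicByTwo G) : Infinite G := by
  obtain ⟨t, ht, -⟩ := h.exists_generator
  refine Infinite.of_injective (fun n : ℤ => t ^ n) fun m n hmn => ?_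
  have : t ^ (m - n) = 1 := by rw [zpow_sub, mul_inv_eq_one]; exact hmn
  exact sub_eq_zero.1 (ht _ this)

/-- A homomorphism to `ℤ` on a subgroup of index at most two is nontrivial at `u` and trivial
at `v`, and the square of `v` is nontrivial. -/
structure RankCertificate (P : Presentation) (ε : List ℕ) (T : CocycleTable) (u v : Word) :
    Prop where
  isCocycle : IsCocycle P ε T
  isTranslation : IsTranslation P ε T u
  snd_eq : (runTrim P ε T v).2 = false
  fst_eq : (runTrim P ε T v).1.1 = (runTrim P ε T v).1.2
  sq_ne : value P (v ++ v) ≠ 1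

/-- Squares lie in any subgroup of index at most two, so `u² = k ^ i` and `v² = k ^ j`. Comparing
the shifts of `k ^ (i * j)` computed through `u` and through `v` gives `j = 0`, that is `v² = 1`. -/
theorem RankCertificate.not_isCyclicByTwo {ε : List ℕ} {T : CocycleTable} {u v : Word}
    (h : RankCertificate P ε T u v) : ¬IsCyclicByTwo (PresGroup P) := by
  intro hG
  obtain ⟨k, hk, h0, h2⟩ := hG.exists_generator
  obtain ⟨s, hs⟩ := exists_coset_rep_of_index_le_two h0 h2
  have hsq : ∀ g, ∃ n : ℤ, k ^ n = g * g := fun g => by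
    rw [← Subgroup.mem_zpowers_iff, ← cosetBit_eq_false, cosetBit_mul hs, Bool.xor_self]
  obtain ⟨F, hF, hF'⟩ := h.isCocycle.exists_translation
  obtain ⟨m, hm, hu⟩ := hF u h.isTranslation
  have hv := hF' v h.snd_eq h.fst_eq
  obtain ⟨i, hi⟩ := hsq (value P u)
  obtain ⟨j, hj⟩ := hsq (value P v)
  have h3 : ShiftsBy (F (k ^ (i * j))) (j * (m + m)) := by
    rw [zpow_mul, hi, map_zpow, map_mul]
    exact (hu.mul hu).zpow j
  have h4 : ShiftsBy (F (k ^ (i * j))) (i * (0 + 0)) := by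
    rw [mul_comm, zpow_mul, hj, map_zpow, map_mul]
    exact (hv.mul hv).zpow i
  have h5 := h3.unique h4
  have h6 : j = 0 := by
    rw [add_zero, mul_zero] at h5
    exact (mul_eq_zero.1 h5).resolve_right (by omega)
  refine h.sq_ne ?_
  rw [value_append, ← hj, h6, zpow_zero]

/-- All sublists of a list, in the order of the list. -/
def subLists (l : List ℕ) : List (List ℕ) := l.foldr (fun x L => L ++ L.map (x :: ·)) [[]]

theorem filter_mem_subLists (p : ℕ → Bool) (l : List ℕ) : l.filter p ∈ subLists l := by
  induction l with
  | nil => simp [subLists]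
  | cons a l ih =>
    change _ ∈ subLists l ++ (subLists l).map (a :: ·)
    rw [List.mem_append, List.filter_cons]
    split_ifs
    · exact Or.inr (List.mem_map.2 ⟨_, ih, rfl⟩)
    · exact Or.inl ih

/-- The words `u` and `v` of even parity do not commute, or `u` is an involution. -/
def Obstructs (P : Presentation) (ε : List ℕ) (u v : Word) : Prop :=
  (runTrim P ε [] u).2 = false ∧ (runTrim P ε [] v).2 = false ∧
    (value P (u ++ v ++ invWord (v ++ u)) ≠ 1 ∨ value P u ≠ 1 ∧ value P (u ++ u) = 1)

/-- Each subgroup of index at most two contains two elements that do not commute, or an involution,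
given by words with codes below `n`. -/
def ParityCertificate (P : Presentation) (n : ℕ) : Prop :=
  ∀ ε ∈ subLists P.1, ¬IsCocycle P ε [] ∨ ∃ m ∈ List.range n,
    Obstructs P ε (codeValue (Word × Word) m).1 (codeValue (Word × Word) m).2

theorem not_obstructs_of_mulEquiv {H : Subgroup (PresGroup P)} (e : H ≃* CycInf) {u v : Word}
    (hu : value P u ∈ H) (hv : value P v ∈ H) :
    value P (u ++ v ++ invWord (v ++ u)) = 1 ∧ (value P (u ++ u) = 1 → value P u = 1) := by
  constructor
  · rw [value_append, value_invWord, mul_inv_eq_one, value_append, value_append]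
    have : (⟨_, hu⟩ * ⟨_, hv⟩ : H) = ⟨_, hv⟩ * ⟨_, hu⟩ := e.injective (by
      rw [map_mul, map_mul, mul_comm])
    exact congrArg Subtype.val this
  · intro h
    rw [value_append] at h
    have h1 : (⟨_, hu⟩ * ⟨_, hu⟩ : H) = 1 := Subtype.ext h
    have h2 := congrArg e h1
    rw [map_mul, map_one] at h2
    have h3 : Multiplicative.toAdd (e ⟨_, hu⟩) + Multiplicative.toAdd (e ⟨_, hu⟩) = 0 := h2
    have h4 : e ⟨_, hu⟩ = 1 := by
      apply Multiplicative.toAdd.injective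
      rw [toAdd_one]; omega
    exact congrArg Subtype.val (e.injective (h4.trans (map_one e).symm))

/-- The parity of an infinite cyclic subgroup of index at most two is among those listed, and words
of even parity lie in it; there they commute and none is an involution. -/
theorem ParityCertificate.not_isCyclicByTwo (hP : P ∈ allPresentations) {n : ℕ}
    (h : ParityCertificate P n) : ¬IsCyclicByTwo (PresGroup P) := by
  rintro ⟨H, h0, h2, ⟨e⟩⟩
  obtain ⟨s, hs⟩ := exists_coset_rep_of_index_le_two h0 h2
  have hmem : ∀ w, (runTrim P (oddGenerators P H) [] w).2 = false → value P w ∈ H := by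
    intro w hw
    rw [runTrim, runWord_oddGenerators_snd hs [] fun _ ha => letter_mem_of_mem_trim ha,
      value_trim] at hw
    rw [← cosetBit_eq_false]
    simpa [zeroState] using hw
  obtain h | ⟨m, -, hu, hv, h⟩ := h _ (filter_mem_subLists _ _)
  · exact h (isCocycle_nil_oddGenerators hP hs)
  · obtain ⟨h1, h2⟩ := not_obstructs_of_mulEquiv e (hmem _ hu) (hmem _ hv)
    exact h.elim (fun h => h h1) fun h => h.1 (h2 h.2)

/-- The stabiliser of `(0, false)`: with the empty table the orbit of this state has at most two
points. -/
theorem exists_even_subgroup {ε : List ℕ} (h : IsCocycle P ε []) :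
    ∃ H : Subgroup (PresGroup P), (H.index ≠ 0 ∧ H.index ≤ 2) ∧
      ∀ w, value P w ∈ H ↔ (runTrim P ε [] w).2 = false := by
  obtain ⟨F, hF, -⟩ := h.exists_hom
  have hval : ∀ w, F (value P w) (0, false) = (0, (runTrim P ε [] w).2) := fun w => by
    have h1 := hF w (zeroState false)
    change F (value P w) (0, false) = _ at h1
    rw [h1, stateValue, runWord_nil_fst]
    rfl
  let H : Subgroup (PresGroup P) :=
    (MulAction.stabilizer (Equiv.Perm (ℤ × Bool)) ((0, false) : ℤ × Bool)).comap F
  have hmem : ∀ g, g ∈ H ↔ F g (0, false) = (0, false) := fun g => Iff.rfl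
  have hw : ∀ w, value P w ∈ H ↔ (runTrim P ε [] w).2 = false := fun w => by
    rw [hmem, hval]; simp
  refine ⟨H, ?_, hw⟩
  by_cases hH : ∀ g, g ∈ H
  · exact index_le_two_of_cosets 1 fun g => Or.inl (hH g)
  · push Not at hH
    obtain ⟨s, hs⟩ := hH
    refine index_le_two_of_cosets s fun g => or_iff_not_imp_left.2 fun hg => ?_
    have key : ∀ g, g ∉ H → F g (0, false) = (0, true) := fun g hg => by
      obtain ⟨w, rfl⟩ := value_surjective g
      rw [hw, Bool.not_eq_false] at hg
      rw [hval, hg]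
    rw [hmem, map_mul, map_inv, Equiv.Perm.mul_apply, key g hg, ← key s hs,
      Equiv.Perm.inv_eq_iff_eq]

end certificates

/-- An infinite finitely generated commutative group maps nontrivially to `ℤ`. -/
theorem exists_hom_int_ne_zero (A : Type*) [AddCommGroup A] [AddGroup.FG A] [Infinite A] :
    ∃ h : A →+ ℤ, ∃ a, h a ≠ 0 := by
  obtain ⟨n, ι, _, p, hp, e, ⟨φ⟩⟩ := AddCommGroup.equiv_free_prod_directSum_zmod A
  obtain hn | ⟨⟨i⟩⟩ := isEmpty_or_nonempty (Fin n)
  · exfalso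
    have : ∀ i, NeZero (p i ^ e i) := fun i => ⟨pow_ne_zero _ (hp i).ne_zero⟩
    have : Finite (DirectSum ι fun i => ZMod (p i ^ e i)) :=
      Finite.of_equiv _ (DirectSum.addEquivProd fun i => ZMod (p i ^ e i)).symm.toEquiv
    have : Finite (Fin n →₀ ℤ) := Finite.of_subsingleton
    have : Finite A := Finite.of_equiv _ φ.symm.toEquiv
    exact not_finite A
  · refine ⟨((Finsupp.applyAddHom i).comp (AddMonoidHom.fst _ _)).comp φ.toAddMonoidHom,
      φ.symm (Finsupp.single i 1, 0), ?_⟩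
    simp

theorem nonempty_equiv_cycInf_of_injective {H : Type*} [Group H] {h : H →* CycInf}
    (hinj : Function.Injective h) [Infinite H] : Nonempty (H ≃* CycInf) := by
  have hcyc : IsCyclic H := isCyclic_of_injective h hinj
  obtain ⟨t, ht⟩ := hcyc.exists_generator
  refine nonempty_equiv_cycInf (t := t) (fun n hn => ?_) ht
  by_contra hn0
  have h1 : IsOfFinOrder t := isOfFinOrder_iff_zpow_eq_one.2 ⟨n, hn0, hn⟩
  have h2 : Finite (Subgroup.zpowers t) := finite_zpowers.2 h1
  have h3 : Finite H := Finite.of_surjective (Subtype.val : Subgroup.zpowers t → H) fun g =>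
    ⟨⟨g, ht g⟩, rfl⟩
  exact not_finite H

/-- The subgroup is infinite, finitely generated and abelian, so it maps nontrivially to `ℤ`. An
injective map would make it infinite cyclic; otherwise a nontrivial kernel element serves as `b`,
its square being nontrivial by `hinv`. -/
theorem exists_hom_of_not_isCyclicByTwo {G : Type*} [Group G] [Group.FG G] [Infinite G]
    (hG : ¬IsCyclicByTwo G) {H : Subgroup G} (h0 : H.index ≠ 0) (h2 : H.index ≤ 2)
    (hcomm : ∀ a ∈ H, ∀ b ∈ H, a * b = b * a) (hinv : ∀ a ∈ H, a * a = 1 → a = 1) :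
    ∃ h : H →* CycInf, ∃ a b : H, h a ≠ 1 ∧ h b = 1 ∧ (b : G) * b ≠ 1 := by
  have : H.FiniteIndex := ⟨h0⟩
  have : Infinite H := by
    by_contra hfin
    have : Finite H := not_infinite_iff_finite.1 hfin
    have h3 := Subgroup.card_mul_index H
    exact (mul_ne_zero Nat.card_pos.ne' h0) (h3.trans Nat.card_eq_zero_of_infinite)
  let _ : CommGroup H :=
    { (inferInstance : Group H) with
      mul_comm := fun a b => Subtype.ext (hcomm a a.2 b b.2) }
  obtain ⟨h, a, ha⟩ := exists_hom_int_ne_zero (Additive H)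
  let f : H →* CycInf := AddMonoidHom.toMultiplicativeRight h
  have hf : f (Additive.toMul a) ≠ 1 := ha
  by_cases hinj : Function.Injective f
  · exact absurd ⟨H, h0, h2, nonempty_equiv_cycInf_of_injective hinj⟩ hG
  · rw [injective_iff_map_eq_one] at hinj
    push Not at hinj
    obtain ⟨b, hb, hb1⟩ := hinj
    exact ⟨f, _, b, hf, hb, fun hbb => hb1 (Subtype.ext (hinv b b.2 hbb))⟩

theorem exists_certificate_of_not_isCyclicByTwo {P : Presentation} (hP : P ∈ allPresentations)
    (hG : ¬IsCyclicByTwo (PresGroup P)) :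
    (∃ L, Exhausts P L) ∨ (∃ ε T u v, RankCertificate P ε T u v) ∨ ∃ n, ParityCertificate P n := by
  by_cases hfin : Finite (PresGroup P)
  · exact Or.inl exists_exhausts
  have : Infinite (PresGroup P) := not_finite_iff_infinite.1 hfin
  refine Or.inr (or_iff_not_imp_right.2 fun hn => ?_)
  -- If every admissible parity were obstructed, one bound on the codes would serve the finitely
  -- many sublists and yield a parity certificate.
  obtain ⟨ε, hε, hob⟩ : ∃ ε, IsCocycle P ε [] ∧ ∀ u v, ¬Obstructs P ε u v := by
    by_contra! hcon
    refine hn (Filter.Eventually.exists (f := Filter.atTop) ?_)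
    unfold ParityCertificate
    refine (Filter.eventually_all_finite (List.finite_toSet (subLists P.1))).2 fun ε _ => ?_
    by_cases hε : IsCocycle P ε []
    · obtain ⟨u, v, huv⟩ := hcon ε hε
      filter_upwards [Filter.eventually_gt_atTop (Encodable.encode (u, v))] with n hn
      exact Or.inr ⟨_, List.mem_range.2 hn, by rwa [codeValue_encode]⟩
    · exact Filter.Eventually.of_forall fun _ => Or.inl hε
  obtain ⟨H, ⟨h0, h2⟩, hH⟩ := exists_even_subgroup hε
  have : Group.FG (PresGroup P) := fg_presGroup
  obtain ⟨h, ⟨a, ha⟩, ⟨b, hb⟩, h3, h4, h5⟩ := exists_hom_of_not_isCyclicByTwo hG h0 h2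
    (by
      intro a ha b hb
      obtain ⟨u, rfl⟩ := value_surjective a
      obtain ⟨v, rfl⟩ := value_surjective b
      by_contra hne
      refine hob u v ⟨(hH u).1 ha, (hH v).1 hb, Or.inl ?_⟩
      rwa [value_append, value_invWord, value_append, value_append, Ne, mul_inv_eq_one])
    (by
      intro a ha hsq
      obtain ⟨u, rfl⟩ := value_surjective a
      by_contra hne
      exact hob u u ⟨(hH u).1 ha, (hH u).1 ha, Or.inr ⟨hne, by rwa [value_append]⟩⟩)
  obtain ⟨u, rfl⟩ := value_surjective a
  obtain ⟨v, rfl⟩ := value_surjective b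
  obtain ⟨s, hs⟩ := exists_coset_rep_of_index_le_two h0 h2
  have hv := stateValue_runWord_of_mem hs h hb
  refine ⟨_, _, u, v, isCocycle_inducedTable hP hs h, isTranslation_inducedTable hs h ha h3,
    congrArg Prod.snd hv, ?_, by rwa [value_append]⟩
  have h6 := congrArg Prod.fst hv
  change ((runTrim P _ (inducedTable hs h) v).1.1 : ℤ) -
    (runTrim P _ (inducedTable hs h) v).1.2 = _ at h6
  rw [h4, toAdd_one] at h6
  omega

/-! ### Computability of the certificates -/

section primrec

variable {α : Type} [Primcodable α]

theorem primrec_invWord : Primrec invWord :=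
  Primrec.list_reverse.comp (Primrec.list_map Primrec.id
    ((Primrec.fst.comp Primrec.snd).pair (Primrec.not.comp (Primrec.snd.comp Primrec.snd))).to₂)

theorem primrec_powWord : Primrec₂ powWord :=
  Primrec.nat_rec (Primrec.const []) (Primrec.list_append.comp₂ Primrec₂.left
    (Primrec.snd.comp₂ Primrec₂.right))

theorem primrec_trim : Primrec₂ trim := by
  have h : PrimrecRel fun (a : ℕ × Bool) (P : Presentation) => a.1 ∈ P.1 :=
    primrecRel_mem.comp (Primrec.fst.comp Primrec.fst) (Primrec.fst.comp Primrec.snd)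
  exact (PrimrecRel.listFilter h).swap

theorem primrec_weight : Primrec₂ weight := by
  have h : Primrec₂ fun (T : CocycleTable) (k : ℕ × Bool) => T.lookup k :=
    (Primrec.listLookup.comp₂ Primrec₂.right Primrec₂.left).of_eq fun T k => by
      congr 1
      exact lawful_beq_subsingleton _ _
  exact Primrec.option_getD.comp₂ h (Primrec₂.const (0, 0))

theorem Primrec.xor : Primrec₂ xor := Primrec.dom_bool₂ _

theorem primrec_stepState {ε : α → List ℕ} {T : α → CocycleTable} {a : α → ℕ × Bool}
    {q : α → RunState} (hε : Primrec ε) (hT : Primrec T) (ha : Primrec a) (hq : Primrec q) :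
    Primrec fun x => stepState (ε x) (T x) (a x) (q x) := by
  have hi := Primrec.fst.comp ha
  have he : Primrec fun x => xor (q x).2 (decide ((a x).1 ∈ ε x)) :=
    Primrec.xor.comp (Primrec.snd.comp hq) (primrecRel_mem.comp hi hε).decide
  have hw := primrec_weight.comp hT (hi.pair (Primrec.snd.comp hq))
  have hw' := primrec_weight.comp hT (hi.pair he)
  have h1 := Primrec.fst.comp (Primrec.fst.comp hq)
  have h2 := Primrec.snd.comp (Primrec.fst.comp hq)
  exact Primrec.cond (Primrec.snd.comp ha)
    (((Primrec.nat_add.comp h1 (Primrec.fst.comp hw)).pair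
      (Primrec.nat_add.comp h2 (Primrec.snd.comp hw))).pair he)
    (((Primrec.nat_add.comp h1 (Primrec.snd.comp hw')).pair
      (Primrec.nat_add.comp h2 (Primrec.fst.comp hw'))).pair he)

theorem primrec_runWord {ε : α → List ℕ} {T : α → CocycleTable} {w : α → Word}
    {q : α → RunState} (hε : Primrec ε) (hT : Primrec T) (hw : Primrec w) (hq : Primrec q) :
    Primrec fun x => runWord (ε x) (T x) (w x) (q x) :=
  Primrec.list_foldr hw hq (primrec_stepState (hε.comp Primrec.fst) (hT.comp Primrec.fst)
    (Primrec.fst.comp Primrec.snd) (Primrec.snd.comp Primrec.snd)).to₂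

theorem primrec_runTrim {P : α → Presentation} {ε : α → List ℕ} {T : α → CocycleTable}
    {w : α → Word} (hP : Primrec P) (hε : Primrec ε) (hT : Primrec T) (hw : Primrec w) :
    Primrec fun x => runTrim (P x) (ε x) (T x) (w x) :=
  primrec_runWord hε hT (primrec_trim.comp hP hw) (Primrec.const (zeroState false))

theorem primrec_subLists : Primrec subLists :=
  Primrec.list_foldr Primrec.id (Primrec.const [[]])
    (Primrec.list_append.comp (Primrec.snd.comp Primrec.snd)
      (Primrec.list_map (Primrec.snd.comp Primrec.snd)
        (Primrec.list_cons.comp (Primrec.fst.comp (Primrec.snd.comp Primrec.fst))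
          Primrec.snd).to₂)).to₂

end primrec

/-! ### Deciding certificates with a solution of the word problem -/

section decOn

variable {D : Set Presentation} {α : Type} [Primcodable α]

theorem WordProblemUniformlySolvable.decOn_value (h : WordProblemUniformlySolvable D)
    {g : Presentation × α → Word} (hg : Primrec g) :
    DecOn D fun P a => value P (g (P, a)) = 1 := by
  obtain ⟨f, hf, H⟩ := h
  refine ⟨fun x => f (x.1, trim x.1 (g x)),
    hf.comp (Primrec.fst.pair (primrec_trim.comp Primrec.fst hg)).to_comp, fun P hP a => ?_⟩
  obtain ⟨v, hv⟩ := exists_spell_eq_trim (P := P) (g (P, a))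
  obtain ⟨b, hb, hb'⟩ := H P hP v
  rw [hv] at hb
  refine ⟨b, hb, hb'.trans ?_⟩
  rw [wordValue_eq_value, hv, value_trim]

theorem decOn_eq {γ : Type} [Primcodable γ] {f g : Presentation × α → γ} (hf : Primrec f)
    (hg : Primrec g) : DecOn D fun P a => f (P, a) = g (P, a) :=
  DecOn.of_primrecPred (Primrec.eq.comp hf hg)

theorem decOn_isCocycle {ε : Presentation × α → List ℕ} {T : Presentation × α → CocycleTable}
    (hε : Primrec ε) (hT : Primrec T) :
    DecOn D fun P a => IsCocycle P (ε (P, a)) (T (P, a)) := by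
  have hx : Primrec fun z : Presentation × ((α × Word) × Bool) => (z.1, z.2.1.1) :=
    Primrec.fst.pair (Primrec.fst.comp (Primrec.fst.comp Primrec.snd))
  have he : Primrec fun z : Presentation × ((α × Word) × Bool) => z.2.2 :=
    Primrec.snd.comp Primrec.snd
  have hr : Primrec fun z : Presentation × ((α × Word) × Bool) =>
      runWord (ε (z.1, z.2.1.1)) (T (z.1, z.2.1.1)) (trim z.1 z.2.1.2) (zeroState z.2.2) :=
    primrec_runWord (hε.comp hx) (hT.comp hx)
      (primrec_trim.comp Primrec.fst (Primrec.snd.comp (Primrec.fst.comp Primrec.snd)))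
      ((Primrec.const (0, 0)).pair he)
  have h1 := decOn_eq (D := D) (Primrec.fst.comp (Primrec.fst.comp hr))
    (Primrec.snd.comp (Primrec.fst.comp hr))
  exact ((h1.and (decOn_eq (Primrec.snd.comp hr) he)).forall_mem
    (Computable.const [false, true])).forall_mem (l := fun x : Presentation × α => x.1.2)
    (Computable.snd.comp Computable.fst)

theorem decOn_isTranslation {ε : Presentation × α → List ℕ} {T : Presentation × α → CocycleTable}
    {w : Presentation × α → Word} (hε : Primrec ε) (hT : Primrec T) (hw : Primrec w) :
    DecOn D fun P a => IsTranslation P (ε (P, a)) (T (P, a)) (w (P, a)) := by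
  have hr := primrec_runTrim Primrec.fst hε hT hw
  exact (decOn_eq (Primrec.snd.comp hr) (Primrec.const false)).and
    (decOn_eq (Primrec.fst.comp (Primrec.fst.comp hr))
      (Primrec.snd.comp (Primrec.fst.comp hr))).not

theorem decOn_isPowerBelow (h : WordProblemUniformlySolvable D) {t u : Presentation × α → Word}
    {N : Presentation × α → ℕ} (ht : Primrec t) (hN : Primrec N) (hu : Primrec u) :
    DecOn D fun P a => IsPowerBelow P (t (P, a)) (N (P, a)) (u (P, a)) := by
  have hx : Primrec fun z : Presentation × (α × ℕ) => (z.1, z.2.1) :=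
    Primrec.fst.pair (Primrec.fst.comp Primrec.snd)
  have hk : Primrec fun z : Presentation × (α × ℕ) => powWord (t (z.1, z.2.1)) z.2.2 :=
    primrec_powWord.comp (ht.comp hx) (Primrec.snd.comp Primrec.snd)
  exact ((h.decOn_value (Primrec.list_append.comp (hu.comp hx) hk)).or
    (h.decOn_value (Primrec.list_append.comp (hu.comp hx) (primrec_invWord.comp hk)))).exists_mem
    (Primrec.list_range.comp hN).to_comp

theorem decOn_permutesCosets (h : WordProblemUniformlySolvable D) {t s : Presentation × α → Word}
    {N : Presentation × α → ℕ} (ht : Primrec t) (hs : Primrec s) (hN : Primrec N) :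
    DecOn D fun P a => PermutesCosets P (t (P, a)) (s (P, a)) (N (P, a)) := by
  have hx : Primrec fun z : Presentation × (((α × ℕ) × Bool) × Word) => (z.1, z.2.1.1.1) :=
    Primrec.fst.pair (Primrec.fst.comp (Primrec.fst.comp (Primrec.fst.comp Primrec.snd)))
  have hu : Primrec fun z : Presentation × (((α × ℕ) × Bool) × Word) =>
      (z.2.1.1.2, z.2.1.2) :: z.2.2 :=
    Primrec.list_cons.comp
      ((Primrec.snd.comp (Primrec.fst.comp (Primrec.fst.comp Primrec.snd))).pair
        (Primrec.snd.comp (Primrec.fst.comp Primrec.snd))) (Primrec.snd.comp Primrec.snd)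
  have hsu := Primrec.list_append.comp (primrec_invWord.comp (hs.comp hx)) hu
  have hl : Primrec fun z : Presentation × ((α × ℕ) × Bool) => [[], s (z.1, z.2.1.1)] :=
    Primrec.list_cons.comp (Primrec.const []) (Primrec.list_cons.comp
      (hs.comp (Primrec.fst.pair (Primrec.fst.comp (Primrec.fst.comp Primrec.snd))))
      (Primrec.const []))
  exact ((((decOn_isPowerBelow h (ht.comp hx) (hN.comp hx) hu).or
    (decOn_isPowerBelow h (ht.comp hx) (hN.comp hx) hsu)).forall_mem hl.to_comp).forall_mem
      (Computable.const [false, true])).forall_mem (l := fun x : Presentation × α => x.1.1)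
      (Computable.fst.comp Computable.fst)

theorem decOn_exhausts (h : WordProblemUniformlySolvable D) :
    DecOn D fun P (L : List Word) => Exhausts P L := by
  have hw : Primrec fun z : Presentation × ((((List Word × Word) × ℕ) × Bool) × Word) =>
      (z.2.1.1.2, z.2.1.2) :: z.2.1.1.1.2 ++ invWord z.2.2 :=
    Primrec.list_append.comp
      (Primrec.list_cons.comp
        ((Primrec.snd.comp (Primrec.fst.comp (Primrec.fst.comp Primrec.snd))).pair
          (Primrec.snd.comp (Primrec.fst.comp Primrec.snd)))
        (Primrec.snd.comp (Primrec.fst.comp (Primrec.fst.comp (Primrec.fst.comp Primrec.snd)))))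
      (primrec_invWord.comp (Primrec.snd.comp Primrec.snd))
  have h1 := (h.decOn_value hw).exists_mem
    (l := fun z : Presentation × (((List Word × Word) × ℕ) × Bool) => z.2.1.1.1)
    (Computable.fst.comp (Computable.fst.comp (Computable.fst.comp Computable.snd)))
  have h2 := ((h1.forall_mem (Computable.const [false, true])).forall_mem
    (l := fun z : Presentation × (List Word × Word) => z.1.1)
    (Computable.fst.comp Computable.fst)).forall_mem
    (l := fun z : Presentation × List Word => z.2) Computable.snd
  exact (decOn_eq Primrec.snd (Primrec.const [])).not.and h2

theorem decOn_parityCertificate (h : WordProblemUniformlySolvable D) :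
    DecOn D fun P (n : ℕ) => ParityCertificate P n := by
  let W := fun z : Presentation × ((ℕ × List ℕ) × ℕ) => codeValue (Word × Word) z.2.2
  have hW : Primrec W := (Primrec.option_getD.comp Primrec.decode (Primrec.const default)).comp
    (Primrec.snd.comp Primrec.snd)
  have hε : Primrec fun z : Presentation × ((ℕ × List ℕ) × ℕ) => z.2.1.2 :=
    Primrec.snd.comp (Primrec.fst.comp Primrec.snd)
  have hu := Primrec.fst.comp hW
  have hv := Primrec.snd.comp hW
  have h1 := decOn_eq (D := D) (Primrec.snd.comp
    (primrec_runTrim Primrec.fst hε (Primrec.const []) hu)) (Primrec.const false)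
  have h2 := decOn_eq (D := D) (Primrec.snd.comp
    (primrec_runTrim Primrec.fst hε (Primrec.const []) hv)) (Primrec.const false)
  have h3 := (h.decOn_value (Primrec.list_append.comp (Primrec.list_append.comp hu hv)
    (primrec_invWord.comp (Primrec.list_append.comp hv hu)))).not
  have h4 := (h.decOn_value hu).not.and (h.decOn_value (Primrec.list_append.comp hu hu))
  have h5 := (h1.and (h2.and (h3.or h4))).exists_mem
    (l := fun z : Presentation × (ℕ × List ℕ) => List.range z.2.1)
    (Primrec.list_range.comp (Primrec.fst.comp Primrec.snd)).to_comp
  have h6 := decOn_isCocycle (D := D) (ε := fun z : Presentation × (ℕ × List ℕ) => z.2.2)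
    (Primrec.snd.comp Primrec.snd) (Primrec.const [])
  exact (h6.not.or h5).forall_mem (l := fun z : Presentation × ℕ => subLists z.1.1)
    (primrec_subLists.comp (Primrec.fst.comp Primrec.fst)).to_comp

theorem decOn_cyclicCertificate (h : WordProblemUniformlySolvable D) :
    DecOn D fun P (c : (List ℕ × CocycleTable) × (Word × Word) × ℕ) =>
      CyclicCertificate P c.1.1 c.1.2 c.2.1.1 c.2.1.2 c.2.2 := by
  have h1 := Primrec.snd (α := Presentation) (β := (List ℕ × CocycleTable) × (Word × Word) × ℕ)
  have hε := Primrec.fst.comp (Primrec.fst.comp h1)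
  have hT := Primrec.snd.comp (Primrec.fst.comp h1)
  have ht := Primrec.fst.comp (Primrec.fst.comp (Primrec.snd.comp h1))
  have hs := Primrec.snd.comp (Primrec.fst.comp (Primrec.snd.comp h1))
  have hN := Primrec.snd.comp (Primrec.snd.comp h1)
  exact ((decOn_isCocycle hε hT).and ((decOn_isTranslation hε hT ht).and
    (decOn_permutesCosets h ht hs hN))).of_iff fun P c =>
      ⟨fun h => ⟨h.1, h.2.1, h.2.2⟩, fun h => ⟨h.1, h.2, h.3⟩⟩

theorem decOn_rankCertificate (h : WordProblemUniformlySolvable D) :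
    DecOn D fun P (c : (List ℕ × CocycleTable) × Word × Word) =>
      RankCertificate P c.1.1 c.1.2 c.2.1 c.2.2 := by
  have h1 := Primrec.snd (α := Presentation) (β := (List ℕ × CocycleTable) × Word × Word)
  have hε := Primrec.fst.comp (Primrec.fst.comp h1)
  have hT := Primrec.snd.comp (Primrec.fst.comp h1)
  have hu := Primrec.fst.comp (Primrec.snd.comp h1)
  have hv := Primrec.snd.comp (Primrec.snd.comp h1)
  have hr := primrec_runTrim Primrec.fst hε hT hv
  exact ((decOn_isCocycle hε hT).and ((decOn_isTranslation hε hT hu).and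
    ((decOn_eq (Primrec.snd.comp hr) (Primrec.const false)).and
      ((decOn_eq (Primrec.fst.comp (Primrec.fst.comp hr))
        (Primrec.snd.comp (Primrec.fst.comp hr))).and
        (h.decOn_value (Primrec.list_append.comp hv hv)).not)))).of_iff fun P c =>
      ⟨fun h => ⟨h.1, h.2.1, h.2.2.1, h.2.2.2.1, h.2.2.2.2⟩, fun h => ⟨h.1, h.2, h.3, h.4, h.5⟩⟩

end decOn

/-- Being cyclic-by-two is recursive modulo the word problem. -/
theorem recursiveModuloWordProblem_of_isCyclicByTwo {C : Set Presentation}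
    (hC : ∀ P ∈ allPresentations, (P ∈ C ↔ IsCyclicByTwo (PresGroup P))) :
    RecursiveModuloWordProblem C := by
  intro D hD h
  have hp := (decOn_cyclicCertificate h).comp (g := fun z : Presentation × ℕ => codeValue _ z.2)
    ((computable_codeValue _).comp Computable.snd)
  -- One number encodes a candidate for each of the three kinds of negative certificate; components
  -- not in use are filled arbitrarily.
  have hc : Computable fun z : Presentation × ℕ =>
      codeValue (List Word × ((List ℕ × CocycleTable) × Word × Word) × ℕ) z.2 :=
    (computable_codeValue _).comp Computable.snd
  have hq := ((decOn_exhausts h).comp (Computable.fst.comp hc)).or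
    (((decOn_rankCertificate h).comp (Computable.fst.comp (Computable.snd.comp hc))).or
      ((decOn_parityCertificate h).comp (Computable.snd.comp (Computable.snd.comp hc))))
  refine isRecursiveIn_of_decOn hD hp hq (fun P hP => ?_) fun P hP => ?_
  · rw [hC P (hD hP)]
    refine ⟨fun hG => ?_, fun ⟨n, hn⟩ => hn.isCyclicByTwo⟩
    obtain ⟨ε, T, t, s, N, hc⟩ := exists_cyclicCertificate (hD hP) hG
    refine ⟨Encodable.encode ((ε, T), (t, s), N), ?_⟩
    simp only [codeValue_encode]
    exact hc
  · rw [hC P (hD hP)]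
    constructor
    · intro hG
      obtain ⟨L, hL⟩ | ⟨ε, T, u, v, hr⟩ | ⟨n, hn⟩ :=
        exists_certificate_of_not_isCyclicByTwo (hD hP) hG
      · refine ⟨Encodable.encode (L, ((([] : List ℕ), ([] : CocycleTable)), ([] : Word),
          ([] : Word)), 0), Or.inl ?_⟩
        simp only [codeValue_encode]
        exact hL
      · refine ⟨Encodable.encode (([] : List Word), ((ε, T), u, v), 0), Or.inr (Or.inl ?_)⟩
        simp only [codeValue_encode]
        exact hr
      · refine ⟨Encodable.encode (([] : List Word), ((([] : List ℕ), ([] : CocycleTable)),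
          ([] : Word), ([] : Word)), n), Or.inr (Or.inr ?_)⟩
        simp only [codeValue_encode]
        exact hn
    · rintro ⟨n, hn | hn | hn⟩ hG
      · have := hn.finite
        have := hG.infinite
        exact not_finite (PresGroup P)
      · exact hn.not_isCyclicByTwo hG
      · exact hn.not_isCyclicByTwo (hD hP) hG

/-- The infinite cyclic group is finitely presented. -/
theorem exists_mem_singletonClass_cycInf : ∃ Q, Q ∈ singletonClass CycInf := by
  refine ⟨([0], []), fun r hr => by simp at hr, ?_⟩
  obtain ⟨F, hF⟩ := exists_hom_of_relators (P := ([0], [])) (K := CycInf)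
    (fun _ => Multiplicative.ofAdd 1) fun r hr => by simp at hr
  refine nonempty_equiv_cycInf (t := genValue ([0], []) 0) (fun n hn => ?_) fun g => ?_
  · have h1 : F (genValue ([0], []) 0) = Multiplicative.ofAdd 1 := by
      have := hF [(0, true)]
      rw [value_letter, cond_true] at this
      rw [this]
      simp [trim, evalWord]
    have h2 := congrArg F hn
    rw [map_zpow, h1] at h2
    have h3 : n • (1 : ℤ) = 0 := congrArg Multiplicative.toAdd (h2.trans (map_one F))
    simpa using h3
  · rw [Subgroup.zpowers_eq_closure]
    have h1 := closure_letters ([0], [])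
    have h2 : {i | i ∈ [0]} = ({0} : Set ℕ) := by ext; simp
    rw [h2, image_singleton] at h1
    rw [h1]
    trivial

/-! ### The class of manifold groups and the main theorem -/

theorem mem_SFPlusEq_iff {P : Presentation} (hP : P ∈ allPresentations) :
    P ∈ SFPlusEq ↔ IsCyclicByTwo (PresGroup P) := by
  rw [← isClosedS2RManifoldGroup_iff_isCyclicByTwo]
  exact and_iff_right hP

theorem SFPlusEq_eq_virtualClass : SFPlusEq = virtualClass 2 (singletonClass CycInf) := by
  ext P
  constructor
  · intro hP
    obtain ⟨H, h0, h2, ⟨e⟩⟩ := (mem_SFPlusEq_iff hP.1).1 hP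
    obtain ⟨Q, hQ, ⟨d⟩⟩ := exists_mem_singletonClass_cycInf
    exact ⟨hP.1, Q, ⟨hQ, H, h0, h2, ⟨d.trans e.symm⟩⟩, hQ, ⟨d⟩⟩
  · rintro ⟨hP, Q, ⟨-, H, h0, h2, ⟨e⟩⟩, -, ⟨d⟩⟩
    exact (mem_SFPlusEq_iff hP).2 ⟨H, h0, h2, ⟨e.symm.trans d⟩⟩

theorem SFPlusEq_eq_union : SFPlusEq = singletonClass CycInf ∪ singletonClass (CycInf × CycTwo) ∪
    singletonClass (Monoid.Coprod CycTwo CycTwo) := by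
  ext P
  have h := isClosedS2RManifoldGroup_iff_equiv (PresGroup P)
  change _ ∧ _ ↔ ((_ ∧ _) ∨ (_ ∧ _)) ∨ (_ ∧ _)
  rw [h]
  tauto

theorem theorem8 :
    RecursiveModuloWordProblem SFPlusEq ∧
    SFPlusEq = virtualClass 2 (singletonClass CycInf) ∧
    SFPlusEq = singletonClass CycInf ∪ singletonClass (CycInf × CycTwo) ∪
      singletonClass (Monoid.Coprod CycTwo CycTwo) ∧
    (∀ (G : Type*) [Group G], IsClosedS2RManifoldGroup G ↔
      (Nonempty (G ≃* CycInf) ∨ Nonempty (G ≃* CycInf × CycTwo) ∨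
        Nonempty (G ≃* Monoid.Coprod CycTwo CycTwo))) ∧
    (∀ (G : Type*) [Group G], IsClosedS2RManifoldGroup G ↔
      ∃ H : Subgroup G, H.index ≠ 0 ∧ H.index ≤ 2 ∧ Nonempty (H ≃* CycInf)) := by
  refine ⟨recursiveModuloWordProblem_of_isCyclicByTwo fun P hP => mem_SFPlusEq_iff hP,
    SFPlusEq_eq_virtualClass, SFPlusEq_eq_union, ?_, ?_⟩
  · intro G _
    exact isClosedS2RManifoldGroup_iff_equiv G
  · intro G _
    exact isClosedS2RManifoldGroup_iff_isCyclicByTwo G
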